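/- Let $k$ be a field of characteristic zero, and let $\mathsf{TKK}$ be the category of $\mathfrak{sl}_2$-modules over $k$ that are (possibly infinite) direct sums of copies of the trivial one-dimensional module $L(0)$ and of the adjoint module $L(2)$, with $\mathfrak{sl}_2$-equivariant maps as morphisms. A commutative associative algebra in $\mathsf{TKK}$ is a unital commutative associative $k$-algebra whose underlying space is an object of $\mathsf{TKK}$ on which $\mathfrak{sl}_2$ acts by derivations; morphisms are $\mathfrak{sl}_2$-equivariant unital algebra homomorphisms. For an object $U$ of $\mathsf{TKK}$, the free commutative associative algebra $\mathrm{Com}^{\mathsf{TKK}}(U)$, with its canonical map $\eta\colon U\to \mathrm{Com}^{\mathsf{TKK}}(U)$, is the value at $U$ of the left adjoint of the forgetful functor from commutative associative algebras in $\mathsf{TKK}$ to $\mathsf{TKK}$. Theorem. For every object $U$ of $\mathsf{TKK}$, the free algebra $A=\mathrm{Com}^{\mathsf{TKK}}(U)$ exists and is a quadratic Koszul algebra with space of generators $U$. That is: (1) (quadratic) the homomorphism $T(U)\to A$ extending $\eta$ is surjective and its kernel is the two-sided ideal generated by a subspace $R\subseteq U\otimes U$, so that $A= T(U)/(R)$;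 (2) (Koszul) the Koszul complex of $A$ is acyclic: if $W_n=\bigcap_{i+2+j=n}U^{\otimes i}\otimes R\otimes U^{\otimes j}\subseteq U^{\otimes n}$ (so $W_0=k$, $W_1=U$, $W_2=R$), then the complex $$\cdots\to A\otimes W_n\to A\otimes W_{n-1}\to\cdots\to A\otimes W_1\to A\otimes W_0\to 0,$$ whose differential is induced by $a\otimes(u_1\otimes\cdots\otimes u_n)\mapsto a\,\eta(u_1)\otimes(u_2\otimes\cdots\otimes u_n)$, has homology $k$, spanned by the class of $1\otimes 1$, in degree $0$, and zero homology in all positive degrees. -/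

import Mathlib

open scoped TensorProduct

universe u v w

namespace TKK

/-! ### The Tits-Kantor-Koecher category -/

/-- The Lie algebra `sl₂` over `k`: traceless `2 × 2` matrices with the commutator bracket. -/
abbrev sl2 (k : Type u) [Field k] : Type u :=
  LieAlgebra.SpecialLinear.sl (Fin 2) k

section Modules

variable (k : Type u) [Field k]
variable (M : Type w) [AddCommGroup M] [Module k M] [LieRingModule (sl2 k) M]
  [LieModule k (sl2 k) M]

/-- `M` is a copy of `L(0)`, the one-dimensional trivial `sl₂`-module. -/
def IsL0 : Prop :=
  LieModule.IsTrivial (sl2 k) M ∧ Module.finrank k M = 1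

/-- `M` is a copy of `L(2)`, the adjoint `sl₂`-module. -/
def IsL2 : Prop :=
  Nonempty (M ≃ₗ⁅k, sl2 k⁆ sl2 k)

/-- `M` is an object of the Tits-Kantor-Koecher category: it is an (internal, possibly infinite)
direct sum of `sl₂`-submodules each of which is a copy of `L(0)` or of `L(2)`. -/
def IsTKK : Prop :=
  ∃ S : Set (LieSubmodule k (sl2 k) M),
    sSupIndep S ∧ sSup S = ⊤ ∧ ∀ N ∈ S, IsL0 k N ∨ IsL2 k N

end Modules

/-- A (unital) commutative associative algebra in the category TKK: a commutative associative
`k`-algebra with an `sl₂`-module structure for which the product is `sl₂`-equivariant (that is,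
`sl₂` acts by derivations) and whose underlying `sl₂`-module is an object of TKK. -/
structure ComAlg (k : Type u) [Field k] : Type (max u (w + 1)) where
  /-- the underlying set -/
  carrier : Type w
  [commRing : CommRing carrier]
  [algebra : Algebra k carrier]
  [lieRingModule : LieRingModule (sl2 k) carrier]
  [lieModule : LieModule k (sl2 k) carrier]
  lie_mul : ∀ (x : sl2 k) (a b : carrier), ⁅x, a * b⁆ = ⁅x, a⁆ * b + a * ⁅x, b⁆
  isTKK : IsTKK k carrier

attribute [instance] ComAlg.commRing ComAlg.algebra ComAlg.lieRingModule ComAlg.lieModule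

/-- `η : U → F` exhibits `F` as the free commutative associative algebra in TKK generated by `U`:
it is a universal arrow from `U` to the forgetful functor from commutative associative algebras
in TKK (with `sl₂`-equivariant unital algebra homomorphisms) to TKK. -/
def IsFreeComAlg {k : Type u} [Field k] {U : Type v} [AddCommGroup U] [Module k U]
    [LieRingModule (sl2 k) U] [LieModule k (sl2 k) U]
    (F : ComAlg.{u, w} k) (η : U →ₗ⁅k, sl2 k⁆ F.carrier) : Prop :=
  ∀ (R : ComAlg.{u, w} k) (φ : U →ₗ⁅k, sl2 k⁆ R.carrier),
    ∃! g : F.carrier →ₐ[k] R.carrier,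
      (∀ (x : sl2 k) (a : F.carrier), g ⁅x, a⁆ = ⁅x, g a⁆) ∧ ∀ y : U, g (η y) = φ y

end TKK

/-! ### Quadratic algebras and Koszul algebras -/

namespace Koszul

section

variable (k : Type u) [Field k] (V : Type v) [AddCommGroup V] [Module k V]

/-- The linear map `T(V) → V ⊗ T(V)` that splits off the first letter:
it sends `1` to `0` and `v * t` to `v ⊗ t`. It is read off from the left action of `T(V)` on
`T(V) × (V ⊗ T(V))` in which `v` sends `(t, m)` to `(v * t, v ⊗ t)`. -/
noncomputable def splitFirst : TensorAlgebra k V →ₗ[k] V ⊗[k] TensorAlgebra k V :=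
  let T := TensorAlgebra k V
  let act : V →ₗ[k] Module.End k (T × (V ⊗[k] T)) :=
    { toFun := fun v =>
        (((LinearMap.mulLeft k (TensorAlgebra.ι k v)).prod (TensorProduct.mk k V T v)).comp
          (LinearMap.fst k T (V ⊗[k] T)))
      map_add' := fun v v' => by
        ext <;> simp [add_mul]
      map_smul' := fun c v => by
        ext <;> simp }
  (LinearMap.snd k T (V ⊗[k] T)).comp
    ((LinearMap.applyₗ ((1 : T), (0 : V ⊗[k] T))).comp (TensorAlgebra.lift k act).toLinearMap)

theorem splitFirst_one : splitFirst k V 1 = 0 := by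
  simp [splitFirst]

theorem splitFirst_ι_mul (v : V) (t : TensorAlgebra k V) :
    splitFirst k V (TensorAlgebra.ι k v * t) = v ⊗ₜ[k] t := by
  suffices h : ∀ (s : TensorAlgebra k V) (act : V →ₗ[k] Module.End k
      (TensorAlgebra k V × (V ⊗[k] TensorAlgebra k V))),
      (∀ v p, (act v p).1 = TensorAlgebra.ι k v * p.1) →
      ∀ p, (TensorAlgebra.lift k act s p).1 = s * p.1 by
    simp [splitFirst, h]
  intro s act hact
  induction s using TensorAlgebra.induction with
  | algebraMap r => intro p; simp [Algebra.smul_def]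
  | ι x => intro p; simp [hact]
  | mul a b ha hb => intro p; simp [ha, hb, mul_assoc]
  | add a b ha hb => intro p; simp [ha, hb, add_mul]

end

section

variable {k : Type u} [Field k] {V : Type v} [AddCommGroup V] [Module k V]
variable {A : Type w} [Ring A] [Algebra k A]

/-- The quadratic relations among the elements `η v` of `A`: the subspace `R` of
`V ⊗ V = T²(V) ⊆ T(V)` of elements that vanish in `A`. -/
noncomputable def relations (η : V →ₗ[k] A) : Submodule k (TensorAlgebra k V) :=
  LinearMap.range (TensorAlgebra.ι k (M := V)) ^ 2 ⊓
    LinearMap.ker (TensorAlgebra.lift k η).toLinearMap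

/-- `A` is a quadratic algebra with space of generators `V` (placed in `A` by `η`): the canonical
homomorphism `T(V) → A` is onto and its kernel is the two-sided ideal generated by
a subspace `R` of `V ⊗ V`, so that `A = T(V) / (R)`. -/
def IsQuadratic (η : V →ₗ[k] A) : Prop :=
  Function.Surjective (TensorAlgebra.lift k η) ∧
    TwoSidedIdeal.ker (TensorAlgebra.lift k η) =
      TwoSidedIdeal.span (relations η : Set (TensorAlgebra k V))

/-- The component of weight `n` of the Koszul dual coalgebra of `T(V) / (R)`: the subspace
`⋂_{i + 2 + j = n} V^{⊗ i} ⊗ R ⊗ V^{⊗ j}` of `V^{⊗ n} ⊆ T(V)`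
(thus `k` for `n = 0`, `V` for `n = 1` and `R` for `n = 2`). -/
noncomputable def dualComponent (η : V →ₗ[k] A) (n : ℕ) : Submodule k (TensorAlgebra k V) :=
  LinearMap.range (TensorAlgebra.ι k (M := V)) ^ n ⊓
    ⨅ (i : ℕ) (j : ℕ) (_ : i + 2 + j = n),
      LinearMap.range (TensorAlgebra.ι k (M := V)) ^ i * relations η *
        LinearMap.range (TensorAlgebra.ι k (M := V)) ^ j

/-- The term `A ⊗ (dual coalgebra)_n` in homological degree `n` of the Koszul complex, as a
subspace of `A ⊗ T(V)`. -/
noncomputable def complexTerm (η : V →ₗ[k] A) (n : ℕ) :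
    Submodule k (A ⊗[k] TensorAlgebra k V) :=
  LinearMap.range ((dualComponent η n).subtype.lTensor A)

/-- The differential of the Koszul complex, as the restriction of the map
`A ⊗ T(V) → A ⊗ T(V)` sending `a ⊗ (v * t)` to `(a * η v) ⊗ t` and `a ⊗ 1` to `0`. -/
noncomputable def differential (η : V →ₗ[k] A) :
    A ⊗[k] TensorAlgebra k V →ₗ[k] A ⊗[k] TensorAlgebra k V :=
  ((LinearMap.mul' k A).rTensor (TensorAlgebra k V)).comp
    ((TensorProduct.assoc k A A (TensorAlgebra k V)).symm.toLinearMap.comp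
      (((η.rTensor (TensorAlgebra k V)).comp (splitFirst k V)).lTensor A))

theorem differential_tmul_one (η : V →ₗ[k] A) (a : A) :
    differential η (a ⊗ₜ[k] 1) = 0 := by
  simp [differential, splitFirst_one]

theorem differential_tmul_ι_mul (η : V →ₗ[k] A) (a : A) (v : V) (t : TensorAlgebra k V) :
    differential η (a ⊗ₜ[k] (TensorAlgebra.ι k v * t)) = (a * η v) ⊗ₜ[k] t := by
  simp [differential, splitFirst_ι_mul]

/-- The Koszul complex `⋯ → A ⊗ R → A ⊗ V → A → 0` is acyclic: its homology is `k`, spanned by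
the class of `1`, in homological degree `0`, and vanishes in all positive degrees. -/
def KoszulComplexAcyclic (η : V →ₗ[k] A) : Prop :=
  (Disjoint (Submodule.span k {(1 : A) ⊗ₜ[k] (1 : TensorAlgebra k V)})
      ((complexTerm η 1).map (differential η)) ∧
    Submodule.span k {(1 : A) ⊗ₜ[k] (1 : TensorAlgebra k V)} ⊔
      (complexTerm η 1).map (differential η) = complexTerm η 0) ∧
  ∀ n : ℕ, complexTerm η (n + 1) ⊓ LinearMap.ker (differential η) =
    (complexTerm η (n + 2)).map (differential η)

/-- `A` is a quadratic Koszul algebra with space of generators `V`: it is quadratic and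
its Koszul complex is acyclic. -/
def IsQuadraticKoszul (η : V →ₗ[k] A) : Prop :=
  IsQuadratic η ∧ KoszulComplexAcyclic η

end

end Koszul

/-! Choose a basis of `U` made of invariant letters z and of triples e, h, f, one triple for each
copy of L(2). In a commutative algebra of TKK a product of two letters of type e has weight 4 and so
vanishes; applying f repeatedly kills the whole copy of L(4) in the product of any two copies of
L(2) (`rel_eq_zero`). Conversely, modulo these quadratic relations a nonzero monomial has at most
one factor e and at most one factor f, so h satisfies h³ = 4h on the quotient
(`smallWeights_freeRing`), and every module with this property lies in TKK (`SmallWeights.isTKK`).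
Hence the free algebra is the polynomial ring in the letters modulo these copies of L(4).

Koszulness comes from Priddy's criterion. Order the letters z < e < h < f, and by label within a
type. The relations rewrite each bad pair of letters into lexicographically smaller pairs. The words
without bad pairs are a sorted word in the z's followed by one of: nothing, e, h, f, e_u h_v (u <
v), h_u f_v (u < v), e_u f_v, e_u h_v f_w (u < v < w). They are linearly independent because an
explicit finite-degree algebra, `Model`, separates them (`linearIndependent_normal`).

The criterion (`IsPBW.isQuadraticKoszul`) is proved with leading words. The pairs u ⊗ w with u free
of bad pairs form a basis of `A ⊗ T(V)`, compared through the word uw. In the leading pair of an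
element of `A ⊗ W_n`, the word w has bad pairs only. For a cycle of positive degree the last letter
of u and the first of w form a bad pair too, so moving that letter across gives a boundary with the
same leading term, provided every word with bad pairs only leads some element of the dual coalgebra
(`HasDualWords`). That statement and exactness support each other in an induction on the weight. -/

namespace Koszul

open Module

/-! ### Words and the lexicographic order in a fixed length -/

section Words

variable {S : Type*} [LinearOrder S]

/-- `Lower x y`: the words `x` and `y` have the same length and `x` is lexicographically
smaller. -/
def Lower (x y : List S) : Prop := x.length = y.length ∧ List.Lex (· < ·) x y

theorem Lower.shortlex {x y : List S} (h : Lower x y) : List.Shortlex (· < ·) x y :=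
  List.Shortlex.of_lex h.1 h.2

theorem Lower.append_left {x y : List S} (h : Lower x y) (s : List S) :
    Lower (s ++ x) (s ++ y) :=
  ⟨by simp [h.1], List.Lex.append_left _ h.2 s⟩

theorem Lower.append_right {x y : List S} (h : Lower x y) (s : List S) :
    Lower (x ++ s) (y ++ s) := by
  refine ⟨by simp [h.1], ?_⟩
  obtain ⟨h1, h2⟩ := h
  induction h2 with
  | nil => simp at h1
  | cons _ ih => exact List.Lex.cons (ih (by simpa using h1))
  | rel h => exact List.Lex.rel h

theorem Lower.trans {x y z : List S} (h : Lower x y) (h' : Lower y z) : Lower x z :=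
  ⟨h.1.trans h'.1, List.lt_trans (show x < y from h.2) (show y < z from h'.2)⟩

/-- The lexicographic order on words of all lengths is not well founded; comparing equal lengths
only embeds the relation into the shortlex order, which is. -/
theorem Lower.wf [WellFoundedLT S] : WellFounded (Lower (S := S)) :=
  Subrelation.wf (fun h => h.shortlex) (List.Shortlex.wf (r := (· < ·)) wellFounded_lt)

theorem shortlex_trans {x y z : List S} (h : List.Shortlex (· < ·) x y)
    (h' : List.Shortlex (· < ·) y z) : List.Shortlex (· < ·) x z := by
  rw [List.shortlex_def] at *
  rcases h with h | ⟨h, h1⟩ <;> rcases h' with h' | ⟨h', h1'⟩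
  · left; omega
  · left; omega
  · left; omega
  · exact Or.inr ⟨h.trans h', List.lt_trans (show x < y from h1) (show y < z from h1')⟩

theorem shortlex_irrefl (x : List S) : ¬ List.Shortlex (· < ·) x x := by
  rw [List.shortlex_def]
  rintro (h | ⟨_, h⟩)
  · exact lt_irrefl _ h
  · exact List.lt_irrefl x h

omit [LinearOrder S] in
theorem exists_of_not_isChain {R : S → S → Prop} : ∀ {w : List S}, ¬ w.IsChain R →
    ∃ x a c y, w = x ++ ([a, c] ++ y) ∧ ¬ R a c
  | [], h => by simp at h
  | [a], h => by simp at h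
  | a :: c :: y, h => by
    by_cases hac : R a c
    · have : ¬ (c :: y).IsChain R := fun h' => h (by simp [hac, h'])
      obtain ⟨x, a', c', y', e, h'⟩ := exists_of_not_isChain this
      exact ⟨a :: x, a', c', y', by rw [e]; rfl, h'⟩
    · exact ⟨[], a, c, y, rfl, hac⟩

/-- A set of words is lower closed if it contains, with a word, all the lexicographically smaller
words of the same length. -/
def LowerClosed (Q : Set (List S)) : Prop := ∀ ⦃x y⦄, x ∈ Q → Lower y x → y ∈ Q

theorem lowerClosed_shortlex (x : List S) :
    LowerClosed {y : List S | List.Shortlex (· < ·) y x} :=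
  fun _ _ h h' => shortlex_trans h'.shortlex h

theorem lowerClosed_lower (x : List S) : LowerClosed {y : List S | Lower y x} :=
  fun _ _ h h' => h'.trans h

theorem LowerClosed.inter {Q Q' : Set (List S)} (h : LowerClosed Q) (h' : LowerClosed Q') :
    LowerClosed (Q ∩ Q') := fun _ _ hx hy => ⟨h hx.1 hy, h' hx.2 hy⟩

end Words

/-! ### Words as a basis of the tensor algebra -/

section

variable {k : Type u} [Field k] {V : Type v} [AddCommGroup V] [Module k V]
variable {A : Type w} [Ring A] [Algebra k A]
variable {S : Type*} (b : Basis S k V)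

/-- The monomial of the tensor algebra spelled by a word in a basis. -/
noncomputable def wd (w : List S) : TensorAlgebra k V :=
  (w.map fun s => TensorAlgebra.ι k (b s)).prod

@[simp] theorem wd_nil : wd b [] = 1 := rfl

theorem wd_append (x y : List S) : wd b (x ++ y) = wd b x * wd b y := by simp [wd]

theorem wd_cons (s : S) (y : List S) : wd b (s :: y) = TensorAlgebra.ι k (b s) * wd b y := by
  simp [wd]

theorem wd_singleton (s : S) : wd b [s] = TensorAlgebra.ι k (b s) := by simp [wd]

/-- The basis of the tensor algebra consisting of the words in a basis. -/
noncomputable def wordBasis : Basis (List S) k (TensorAlgebra k V) :=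
  b.tensorAlgebra.reindex FreeMonoid.toList

@[simp] theorem wordBasis_apply (w : List S) : wordBasis b w = wd b w := by
  rw [wordBasis, Basis.reindex_apply, Basis.tensorAlgebra, Basis.map_apply]
  have : (FreeAlgebra.basisFreeMonoid k S) (FreeMonoid.toList.symm w) =
      (w.map (FreeAlgebra.ι k)).prod := by
    simp [FreeAlgebra.basisFreeMonoid, FreeAlgebra.equivMonoidAlgebraFreeMonoid,
      MonoidAlgebra.lift_single, FreeMonoid.lift_apply]
  rw [this]
  simp [wd, map_list_prod, Function.comp_def]

/-- The span of a set of words. -/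
noncomputable def spanW (Q : Set (List S)) : Submodule k (TensorAlgebra k V) :=
  Submodule.span k (wd b '' Q)

theorem wd_mem_spanW {Q : Set (List S)} {w : List S} (h : w ∈ Q) : wd b w ∈ spanW b Q :=
  Submodule.subset_span ⟨w, h, rfl⟩

theorem spanW_mono {Q Q' : Set (List S)} (h : Q ⊆ Q') : spanW b Q ≤ spanW b Q' :=
  Submodule.span_mono (Set.image_mono h)

theorem range_ι_eq : LinearMap.range (TensorAlgebra.ι k (M := V)) =
    spanW b {w | w.length = 1} := by
  rw [LinearMap.range_eq_map, ← b.span_eq, Submodule.map_span, spanW]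
  congr 1
  ext x
  simp only [Set.mem_image, Set.mem_range, Set.mem_ofPred_eq, List.length_eq_one_iff]
  constructor
  · rintro ⟨_, ⟨s, rfl⟩, rfl⟩
    exact ⟨[s], ⟨s, rfl⟩, wd_singleton b s⟩
  · rintro ⟨_, ⟨s, rfl⟩, rfl⟩
    exact ⟨_, ⟨s, rfl⟩, (wd_singleton b s).symm⟩

theorem spanW_mul (Q Q' : Set (List S)) :
    spanW b Q * spanW b Q' = spanW b (Set.image2 (· ++ ·) Q Q') := by
  rw [spanW, spanW, Submodule.span_mul_span, spanW, Set.image_image2, ← Set.image2_mul,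
    Set.image2_image_left, Set.image2_image_right]
  simp only [wd_append]

theorem range_ι_pow (n : ℕ) : LinearMap.range (TensorAlgebra.ι k (M := V)) ^ n =
    spanW b {w | w.length = n} := by
  induction n with
  | zero =>
    rw [pow_zero, Submodule.one_eq_span, spanW]
    congr 1
    ext x
    simp [List.length_eq_zero_iff]
  | succ n ih =>
    rw [pow_succ', ih, range_ι_eq b, spanW_mul]
    congr 1
    ext x
    simp only [Set.mem_image2, Set.mem_ofPred_eq]
    constructor
    · rintro ⟨x, h, y, h', rfl⟩
      simp [h, h', add_comm]
    · intro h
      obtain ⟨s, w, rfl⟩ := List.exists_cons_of_length_eq_add_one h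
      exact ⟨[s], rfl, w, by simpa using h, rfl⟩

end

end Koszul

namespace Koszul

open Module

/-! ### PBW bases, normal forms, quadraticity -/

section

variable {k : Type u} [Field k] {V : Type v} [AddCommGroup V] [Module k V]
variable {A : Type w} [Ring A] [Algebra k A]
variable {S : Type*} [LinearOrder S]

/-- A Poincaré-Birkhoff-Witt basis of a quadratic algebra: the images of the words all of whose
pairs of neighbours are good are linearly independent, and the product of a bad pair of generators
is a combination of products of lexicographically smaller pairs. -/
structure IsPBW (b : Basis S k V) (η : V →ₗ[k] A) (good : S → S → Prop) : Prop where
  surjective : Function.Surjective (TensorAlgebra.lift k η)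
  linearIndependent : LinearIndependent k
    fun w : {w : List S // w.IsChain good} => TensorAlgebra.lift k η (wd b w)
  reduce : ∀ a c, ¬ good a c → TensorAlgebra.lift k η (wd b [a, c]) ∈
    (spanW b {w | Lower w [a, c]}).map (TensorAlgebra.lift k η).toLinearMap

variable {b : Basis S k V} {η : V →ₗ[k] A} {good : S → S → Prop}

theorem IsPBW.exists_relation (h : IsPBW b η good) {a c : S} (hac : ¬ good a c) :
    ∃ p ∈ spanW b {w | Lower w [a, c]}, wd b [a, c] - p ∈ relations η := by
  obtain ⟨p, hp, e⟩ := h.reduce a c hac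
  refine ⟨p, hp, ?_, ?_⟩
  · rw [range_ι_pow b]
    exact sub_mem (wd_mem_spanW b rfl) (spanW_mono b (fun w hw => hw.1) hp)
  · simpa [sub_eq_zero] using e.symm

omit [LinearOrder S] in
theorem wd_mul_spanW_mul (x y : List S) {Q Q' : Set (List S)}
    (hQ : ∀ w ∈ Q, x ++ (w ++ y) ∈ Q') {p : TensorAlgebra k V} (hp : p ∈ spanW b Q) :
    wd b x * (p * wd b y) ∈ spanW b Q' := by
  have : (spanW b Q).map ((LinearMap.mulLeft k (wd b x)).comp (LinearMap.mulRight k (wd b y))) ≤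
      spanW b Q' := by
    rw [spanW, Submodule.map_span, Submodule.span_le]
    rintro _ ⟨_, ⟨w, hw, rfl⟩, rfl⟩
    simpa [wd_append] using wd_mem_spanW b (hQ w hw)
  exact this ⟨p, hp, rfl⟩

/-- Modulo the ideal of relations, a word with a bad pair is a combination of smaller words
without bad pairs. -/
theorem IsPBW.wd_mem [WellFoundedLT S] (h : IsPBW b η good) {J : Submodule k (TensorAlgebra k V)}
    (hl : ∀ x, ∀ y ∈ J, x * y ∈ J) (hr : ∀ x, ∀ y ∈ J, y * x ∈ J) (hJ : relations η ≤ J)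
    (w : List S) (hw : ¬ w.IsChain good) :
    wd b w ∈ spanW b {u | u.IsChain good ∧ Lower u w} ⊔ J := by
  induction w using (Lower.wf (S := S)).induction with
  | _ w ih =>
    -- One bad pair is replaced by smaller pairs at the cost of an element of `J`; the words that
    -- result are smaller than `w`, and the induction treats those that still contain bad pairs.
    obtain ⟨x, a, c, y, rfl, hac⟩ := exists_of_not_isChain hw
    obtain ⟨p, hp, hpr⟩ := h.exists_relation hac
    have e : wd b (x ++ ([a, c] ++ y)) = wd b x * (p * wd b y) +
        wd b x * ((wd b [a, c] - p) * wd b y) := by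
      rw [wd_append, wd_append, ← mul_add, ← add_mul, add_sub_cancel]
    rw [e]
    refine add_mem ?_ (Submodule.mem_sup_right (hl _ _ (hr _ _ (hJ hpr))))
    have hsub : spanW b {u | Lower u (x ++ ([a, c] ++ y))} ≤
        spanW b {u | u.IsChain good ∧ Lower u (x ++ ([a, c] ++ y))} ⊔ J := by
      rw [spanW, Submodule.span_le]
      rintro _ ⟨u, hu, rfl⟩
      by_cases hg : u.IsChain good
      · exact Submodule.mem_sup_left (wd_mem_spanW b ⟨hg, hu⟩)
      · refine sup_le_sup_right (spanW_mono b ?_) J (ih u hu hg)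
        exact fun z hz => ⟨hz.1, hz.2.trans hu⟩
    exact hsub (wd_mul_spanW_mul x y (fun w hw => (hw.append_right y).append_left x) hp)

theorem IsPBW.lift_wd_mem [WellFoundedLT S] (h : IsPBW b η good)
    (w : List S) (hw : ¬ w.IsChain good) :
    TensorAlgebra.lift k η (wd b w) ∈ (spanW b {u | u.IsChain good ∧ Lower u w}).map
      (TensorAlgebra.lift k η).toLinearMap := by
  have := h.wd_mem (J := LinearMap.ker (TensorAlgebra.lift k η).toLinearMap)
    (fun x y hy => by simp_all) (fun x y hy => by simp_all) inf_le_right w hw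
  obtain ⟨p, hp, q, hq, e⟩ := Submodule.mem_sup.1 this
  exact ⟨p, hp, by rw [← e]; simpa using hq⟩

theorem IsPBW.top_le_span [WellFoundedLT S] (h : IsPBW b η good) :
    ⊤ ≤ Submodule.span k (Set.range
      fun w : {w : List S // w.IsChain good} => TensorAlgebra.lift k η (wd b w)) := by
  have key : ∀ w, TensorAlgebra.lift k η (wd b w) ∈ Submodule.span k (Set.range
      fun w : {w : List S // w.IsChain good} => TensorAlgebra.lift k η (wd b w)) := by
    intro w
    by_cases hw : w.IsChain good
    · exact Submodule.subset_span ⟨⟨w, hw⟩, rfl⟩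
    · obtain ⟨p, hp, e⟩ := h.lift_wd_mem w hw
      rw [← e]
      have : (spanW b {u | u.IsChain good ∧ Lower u w}).map
          (TensorAlgebra.lift k η).toLinearMap ≤ Submodule.span k (Set.range
            fun w : {w : List S // w.IsChain good} => TensorAlgebra.lift k η (wd b w)) := by
        rw [spanW, Submodule.map_span]
        refine Submodule.span_mono ?_
        rintro _ ⟨_, ⟨u, hu, rfl⟩, rfl⟩
        exact ⟨⟨u, hu.1⟩, rfl⟩
      exact this ⟨p, hp, rfl⟩
  have hT : (⊤ : Submodule k A) = (Submodule.span k (Set.range (wordBasis b))).map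
      (TensorAlgebra.lift k η).toLinearMap := by
    rw [Basis.span_eq, Submodule.map_top, eq_comm, LinearMap.range_eq_top]
    exact h.surjective
  rw [hT, Submodule.map_span, Submodule.span_le]
  rintro _ ⟨_, ⟨w, rfl⟩, rfl⟩
  simpa using key w

/-- The basis of a PBW algebra consisting of the words without bad pairs. -/
noncomputable def IsPBW.basis [WellFoundedLT S] (h : IsPBW b η good) :
    Basis {w : List S // w.IsChain good} k A :=
  Basis.mk h.linearIndependent h.top_le_span

theorem IsPBW.basis_apply [WellFoundedLT S] (h : IsPBW b η good)
    (w : {w : List S // w.IsChain good}) : h.basis w = TensorAlgebra.lift k η (wd b w) := by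
  simp [IsPBW.basis]

/-- The normal form of an element of the tensor algebra. -/
noncomputable def IsPBW.normalForm [WellFoundedLT S] (h : IsPBW b η good) :
    TensorAlgebra k V →ₗ[k] TensorAlgebra k V :=
  (h.basis.constr k fun w => wd b w).comp (TensorAlgebra.lift k η).toLinearMap

theorem IsPBW.normalForm_wd [WellFoundedLT S] (h : IsPBW b η good) {w : List S}
    (hw : w.IsChain good) : h.normalForm (wd b w) = wd b w := by
  have := h.basis_apply ⟨w, hw⟩
  simp only at this
  simp [IsPBW.normalForm, ← this, Basis.constr_basis]

theorem IsPBW.normalForm_spanW [WellFoundedLT S] (h : IsPBW b η good) {Q : Set (List S)}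
    (hQ : ∀ w ∈ Q, w.IsChain good) {p : TensorAlgebra k V} (hp : p ∈ spanW b Q) :
    h.normalForm p = p := by
  have : spanW b Q ≤ LinearMap.eqLocus h.normalForm LinearMap.id := by
    rw [spanW, Submodule.span_le]
    rintro _ ⟨w, hw, rfl⟩
    exact h.normalForm_wd (hQ w hw)
  exact this hp

theorem IsPBW.normalForm_congr [WellFoundedLT S] (h : IsPBW b η good) {p q : TensorAlgebra k V}
    (e : TensorAlgebra.lift k η p = TensorAlgebra.lift k η q) :
    h.normalForm p = h.normalForm q := by
  simp [IsPBW.normalForm, e]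

theorem IsPBW.normalForm_wd_mem [WellFoundedLT S] (h : IsPBW b η good) {w : List S}
    (hw : ¬ w.IsChain good) : h.normalForm (wd b w) ∈ spanW b {u | Lower u w} := by
  obtain ⟨p, hp, e⟩ := h.lift_wd_mem w hw
  rw [← h.normalForm_congr e, h.normalForm_spanW (fun w hw => hw.1) hp]
  exact spanW_mono b (fun _ hu => hu.2) hp

/-- PBW algebras are quadratic. -/
theorem IsPBW.isQuadratic [WellFoundedLT S] (h : IsPBW b η good) : IsQuadratic η := by
  refine ⟨h.surjective, le_antisymm ?_ ?_⟩
  · set I := TwoSidedIdeal.span (relations η : Set (TensorAlgebra k V)) with hI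
    let J : Submodule k (TensorAlgebra k V) :=
      { carrier := I
        add_mem' := fun ha hb => I.add_mem ha hb
        zero_mem' := I.zero_mem
        smul_mem' := fun c x hx => by
          rw [Algebra.smul_def]
          exact I.mul_mem_left _ _ hx }
    have hred := h.wd_mem (J := J) (fun x y hy => I.mul_mem_left _ _ hy)
      (fun x y hy => I.mul_mem_right _ _ hy) (fun x hx => TwoSidedIdeal.subset_span hx)
    have htop : ∀ x, x ∈ spanW b {u | u.IsChain good} ⊔ J := by
      intro x
      have : (⊤ : Submodule k (TensorAlgebra k V)) ≤ spanW b {u | u.IsChain good} ⊔ J := by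
        rw [← (wordBasis b).span_eq, Submodule.span_le]
        rintro _ ⟨w, rfl⟩
        rw [wordBasis_apply]
        by_cases hw : w.IsChain good
        · exact Submodule.mem_sup_left (wd_mem_spanW b hw)
        · exact sup_le_sup_right (spanW_mono b fun u hu => hu.1) _ (hred w hw)
      exact this trivial
    have hJ : ∀ x ∈ J, TensorAlgebra.lift k η x = 0 := by
      intro x hx
      have : I ≤ TwoSidedIdeal.ker (TensorAlgebra.lift k η) :=
        TwoSidedIdeal.span_le.2 fun y hy => by
          rw [SetLike.mem_coe, TwoSidedIdeal.mem_ker]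
          simpa using hy.2
      exact (TwoSidedIdeal.mem_ker _).1 (this hx)
    intro x hx
    rw [TwoSidedIdeal.mem_ker] at hx
    obtain ⟨p, hp, q, hq, rfl⟩ := Submodule.mem_sup.1 (htop x)
    -- `p` is a combination of good words with zero image in `A`; independence of those images, in
    -- the form of the normal form map, forces `p = 0`, so that `x` lies in the ideal.
    have h0 : h.normalForm p = h.normalForm 0 := h.normalForm_congr (by simpa [hJ q hq] using hx)
    rw [h.normalForm_spanW (fun w hw => hw) hp, map_zero] at h0
    rw [h0, zero_add]
    exact hq
  · refine TwoSidedIdeal.span_le.2 fun y hy => ?_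
    rw [SetLike.mem_coe, TwoSidedIdeal.mem_ker]
    simpa using hy.2

end

end Koszul

namespace Koszul

open Module

/-! ### Leading words in `A ⊗ T(V)` -/

section

variable {k : Type u} [Field k] {V : Type v} [AddCommGroup V] [Module k V]
variable {A : Type w} [Ring A] [Algebra k A]
variable {S : Type*} [LinearOrder S]
variable (b : Basis S k V) (η : V →ₗ[k] A) {good : S → S → Prop}

/-- The element `u ⊗ w` of `A ⊗ T(V)` for two words `u` and `w`. -/
noncomputable def tw (u w : List S) : A ⊗[k] TensorAlgebra k V :=
  TensorAlgebra.lift k η (wd b u) ⊗ₜ[k] wd b w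

omit [LinearOrder S] in
theorem differential_tw_cons (u w : List S) (s : S) :
    differential η (tw b η u (s :: w)) = tw b η (u ++ [s]) w := by
  rw [tw, wd_cons, differential_tmul_ι_mul, tw, wd_append, map_mul, wd_singleton,
    TensorAlgebra.lift_ι_apply]

/-- The span of the elements `u ⊗ w` where `w` has length `n` and `uw` belongs to `Q`. -/
noncomputable def Sp (n : ℕ) (Q : Set (List S)) : Submodule k (A ⊗[k] TensorAlgebra k V) :=
  Submodule.span k {z | ∃ u w : List S, w.length = n ∧ u ++ w ∈ Q ∧ tw b η u w = z}

omit [LinearOrder S] in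
theorem tw_mem_Sp {n : ℕ} {Q : Set (List S)} {u w : List S} (hw : w.length = n)
    (hQ : u ++ w ∈ Q) : tw b η u w ∈ Sp b η n Q :=
  Submodule.subset_span ⟨u, w, hw, hQ, rfl⟩

omit [LinearOrder S] in
theorem Sp_mono {n : ℕ} {Q Q' : Set (List S)} (h : Q ⊆ Q') : Sp b η n Q ≤ Sp b η n Q' :=
  Submodule.span_mono fun _ ⟨u, w, hw, hQ, e⟩ => ⟨u, w, hw, h hQ, e⟩

omit [LinearOrder S] in
theorem differential_mem_Sp {n : ℕ} {Q : Set (List S)} {z : A ⊗[k] TensorAlgebra k V}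
    (hz : z ∈ Sp b η (n + 1) Q) : differential η z ∈ Sp b η n Q := by
  have : (Sp b η (n + 1) Q).map (differential η) ≤ Sp b η n Q := by
    rw [Sp, Submodule.map_span, Submodule.span_le]
    rintro _ ⟨_, ⟨u, w, hw, hQ, rfl⟩, rfl⟩
    obtain ⟨s, w, rfl⟩ := List.exists_cons_of_length_eq_add_one hw
    rw [differential_tw_cons]
    exact tw_mem_Sp b η (by simpa using hw) (by simpa using hQ)
  exact this ⟨z, hz, rfl⟩

omit [LinearOrder S] in
theorem tmul_mem_Sp {n : ℕ} {Q Q' : Set (List S)} (u : List S) {t : TensorAlgebra k V}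
    (ht : t ∈ spanW b Q) (hn : ∀ w ∈ Q, w.length = n) (hQ : ∀ w ∈ Q, u ++ w ∈ Q') :
    TensorAlgebra.lift k η (wd b u) ⊗ₜ[k] t ∈ Sp b η n Q' := by
  have : (spanW b Q).map (TensorProduct.mk k A (TensorAlgebra k V)
      (TensorAlgebra.lift k η (wd b u))) ≤ Sp b η n Q' := by
    rw [spanW, Submodule.map_span, Submodule.span_le]
    rintro _ ⟨_, ⟨w, hw, rfl⟩, rfl⟩
    exact tw_mem_Sp b η (hn w hw) (hQ w hw)
  exact this ⟨t, ht, rfl⟩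

variable {b η}

theorem IsPBW.tmul_wd_mem_Sp [WellFoundedLT S] (h : IsPBW b η good) {n : ℕ} {Q : Set (List S)}
    {u w : List S} (hw : w.length = n) (hQ : ∀ y, Lower y (u ++ w) → y ∈ Q)
    (hu : ¬ u.IsChain good) :
    tw b η u w ∈ Submodule.span k {z | ∃ u w : List S, u.IsChain good ∧ w.length = n ∧
      u ++ w ∈ Q ∧ tw b η u w = z} := by
  obtain ⟨p, hp, e⟩ := h.lift_wd_mem u hu
  rw [tw, ← e]
  have : ((spanW b {x | x.IsChain good ∧ Lower x u}).map
      (TensorAlgebra.lift k η).toLinearMap).map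
      ((TensorProduct.mk k A (TensorAlgebra k V)).flip (wd b w)) ≤
      Submodule.span k {z | ∃ u w : List S, u.IsChain good ∧ w.length = n ∧
      u ++ w ∈ Q ∧ tw b η u w = z} := by
    rw [spanW, Submodule.map_span, Submodule.map_span, Submodule.span_le]
    rintro _ ⟨_, ⟨_, ⟨x, hx, rfl⟩, rfl⟩, rfl⟩
    exact Submodule.subset_span ⟨x, w, hx.1, hw, hQ _ (hx.2.append_right w), rfl⟩
  exact this ⟨_, ⟨p, hp, rfl⟩, rfl⟩

/-- Rewriting `u` into good words only lowers `u ++ w`, so a lower closed `Q` is not left. This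
turns `Sp` into the span of a subset of the basis `basisTw`, on which leading terms make sense. -/
theorem IsPBW.Sp_eq [WellFoundedLT S] (h : IsPBW b η good) (n : ℕ) {Q : Set (List S)}
    (hQ : LowerClosed Q) : Sp b η n Q = Submodule.span k {z | ∃ u w : List S,
      u.IsChain good ∧ w.length = n ∧ u ++ w ∈ Q ∧ tw b η u w = z} := by
  refine le_antisymm (Submodule.span_le.2 ?_)
    (Submodule.span_mono fun _ ⟨u, w, _, hw, hQ, e⟩ => ⟨u, w, hw, hQ, e⟩)
  rintro _ ⟨u, w, hw, hQ', rfl⟩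
  by_cases hu : u.IsChain good
  · exact Submodule.subset_span ⟨u, w, hu, hw, hQ', rfl⟩
  · exact h.tmul_wd_mem_Sp hw (fun y hy => hQ hQ' hy) hu

/-- The basis of `A ⊗ T(V)` consisting of the pairs of words, the first without bad pairs. -/
noncomputable def IsPBW.basisTw [WellFoundedLT S] (h : IsPBW b η good) :
    Basis ({w : List S // w.IsChain good} × List S) k (A ⊗[k] TensorAlgebra k V) :=
  h.basis.tensorProduct (wordBasis b)

theorem IsPBW.basisTw_apply [WellFoundedLT S] (h : IsPBW b η good)
    (i : {w : List S // w.IsChain good} × List S) : h.basisTw i = tw b η i.1 i.2 := by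
  rw [IsPBW.basisTw, Basis.tensorProduct_apply', wordBasis_apply, h.basis_apply]
  rfl

theorem IsPBW.Sp_eq_image [WellFoundedLT S] (h : IsPBW b η good) (n : ℕ) {Q : Set (List S)}
    (hQ : LowerClosed Q) : Sp b η n Q = Submodule.span k (h.basisTw ''
      {i | i.2.length = n ∧ i.1.1 ++ i.2 ∈ Q}) := by
  rw [h.Sp_eq n hQ]
  congr 1
  ext z
  constructor
  · rintro ⟨u, w, hu, hw, hQ, rfl⟩
    exact ⟨⟨⟨u, hu⟩, w⟩, ⟨hw, hQ⟩, h.basisTw_apply _⟩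
  · rintro ⟨⟨⟨u, hu⟩, w⟩, ⟨hw, hQ⟩, rfl⟩
    exact ⟨u, w, hu, hw, hQ, (h.basisTw_apply (⟨u, hu⟩, w)).symm⟩

theorem IsPBW.eq_zero_of_smul_tw_mem [WellFoundedLT S] (h : IsPBW b η good) {n : ℕ}
    {Q : Set (List S)} (hQ : LowerClosed Q) {u w : List S} (hu : u.IsChain good)
    (hx : u ++ w ∉ Q) {c : k} (hc : c • tw b η u w ∈ Sp b η n Q) : c = 0 := by
  rw [h.Sp_eq_image n hQ, Basis.mem_span_image] at hc
  by_contra h0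
  have e : tw b η u w = h.basisTw (⟨u, hu⟩, w) :=
    (h.basisTw_apply (⟨u, hu⟩, w)).symm
  have := hc (show (⟨u, hu⟩, w) ∈ _ by
    rw [e, map_smul, Basis.repr_self]
    simp [h0])
  exact hx this.2

/-- The leading term is the shortlex-largest concatenation in the support. Shortlex is needed
because elements of `A` may mix words of different lengths. -/
theorem IsPBW.exists_leading [WellFoundedLT S] (h : IsPBW b η good) {n : ℕ}
    {Q : Set (List S)} (hQ : LowerClosed Q) {z : A ⊗[k] TensorAlgebra k V}
    (hz : z ∈ Sp b η n Q) (hz0 : z ≠ 0) : ∃ (u w : List S) (c : k), u.IsChain good ∧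
      w.length = n ∧ c ≠ 0 ∧ u ++ w ∈ Q ∧
      z - c • tw b η u w ∈ Sp b η n (Q ∩ {y | List.Shortlex (· < ·) y (u ++ w)}) := by
  rw [h.Sp_eq_image n hQ, Basis.mem_span_image] at hz
  have hne : (h.basisTw.repr z).support.Nonempty := by
    simpa [Finsupp.support_nonempty_iff] using hz0
  obtain ⟨i, hi, hmax⟩ := Finset.exists_max_image _
    (fun i : {w : List S // w.IsChain good} × List S =>
      toLex ((i.1.1 ++ i.2).length, i.1.1 ++ i.2)) hne
  have hi' := hz hi
  refine ⟨i.1, i.2, h.basisTw.repr z i, i.1.2, hi'.1, by simpa using hi, hi'.2, ?_⟩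
  rw [h.Sp_eq_image n (hQ.inter (lowerClosed_shortlex _)), Basis.mem_span_image]
  intro j hj
  rw [← h.basisTw_apply i, map_sub, map_smul, Basis.repr_self] at hj
  have hij : j ≠ i := by
    rintro rfl
    simp at hj
  have hj' : j ∈ (h.basisTw.repr z).support := by
    simpa [Finsupp.single_apply, hij.symm] using hj
  refine ⟨(hz hj').1, (hz hj').2, ?_⟩
  rcases (hmax j hj').lt_or_eq with hlt | heq
  · rw [Prod.Lex.lt_iff] at hlt
    exact List.shortlex_def.2 hlt
  -- The second words all have length `n`, so a concatenation determines the pair: there are no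
  -- ties.
  · have e : j.1.1 ++ j.2 = i.1.1 ++ i.2 := congrArg (fun x => (ofLex x).2) heq
    have := List.append_inj' e ((hz hj').1.trans hi'.1.symm)
    exact absurd (Prod.ext (Subtype.ext this.1) this.2) hij

omit [LinearOrder S] in
theorem complexTerm_induction {P : Submodule k (A ⊗[k] TensorAlgebra k V)} {n : ℕ}
    (hP : ∀ a, ∀ t ∈ dualComponent η n, a ⊗ₜ[k] t ∈ P) : complexTerm η n ≤ P := by
  rintro _ ⟨q, rfl⟩
  induction q with
  | zero => simp
  | tmul a t => exact hP a t t.2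
  | add x y hx hy => rw [map_add]; exact add_mem hx hy

omit [LinearOrder S] in
theorem tmul_mem_complexTerm {n : ℕ} (a : A) {t : TensorAlgebra k V}
    (ht : t ∈ dualComponent η n) : a ⊗ₜ[k] t ∈ complexTerm η n :=
  ⟨a ⊗ₜ[k] ⟨t, ht⟩, by simp⟩

end

end Koszul

namespace Koszul

open Module

/-! ### The Koszul differential and the leading words of its terms -/

section

variable {k : Type u} [Field k] {V : Type v} [AddCommGroup V] [Module k V]
variable {A : Type w} [Ring A] [Algebra k A]
variable {S : Type*}
variable {b : Basis S k V} {η : V →ₗ[k] A}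

theorem spanW_induction {Q : Set (List S)} {P : (t : TensorAlgebra k V) → t ∈ spanW b Q → Prop}
    (hw : ∀ w, ∀ h : w ∈ Q, P (wd b w) (wd_mem_spanW b h)) (h0 : P 0 (zero_mem _))
    (hadd : ∀ x y hx hy, P x hx → P y hy → P (x + y) (add_mem hx hy))
    (hs : ∀ (c : k) x hx, P x hx → P (c • x) (Submodule.smul_mem _ c hx))
    {t : TensorAlgebra k V} (ht : t ∈ spanW b Q) : P t ht := by
  induction ht using Submodule.span_induction with
  | mem x hx => obtain ⟨w, h, rfl⟩ := hx; exact hw w h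
  | zero => exact h0
  | add x y _ _ hx hy => exact hadd x y _ _ hx hy
  | smul c x _ hx => exact hs c x _ hx

theorem spanW_univ : spanW b Set.univ = ⊤ := by
  rw [← (wordBasis b).span_eq, spanW, Set.image_univ]
  congr
  ext
  simp

open Classical in
variable (b) in
/-- Division by a letter on the left. -/
noncomputable def leftDiv (s : S) : TensorAlgebra k V →ₗ[k] TensorAlgebra k V :=
  (wordBasis b).constr k fun w => match w with
    | [] => 0
    | c :: w => if c = s then wd b w else 0

open Classical in
theorem leftDiv_wd_cons (s c : S) (w : List S) :
    leftDiv b s (wd b (c :: w)) = if c = s then wd b w else 0 := by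
  rw [leftDiv, ← wordBasis_apply, Basis.constr_basis]

open Classical in
theorem leftDiv_ι_mul (s c : S) (t : TensorAlgebra k V) :
    leftDiv b s (TensorAlgebra.ι k (b c) * t) = if c = s then t else 0 := by
  have ht : t ∈ spanW b Set.univ := by rw [spanW_univ]; trivial
  induction ht using spanW_induction with
  | h0 => simp
  | hadd x x' _ _ hx hx' => rw [mul_add, map_add, hx, hx']; split_ifs <;> simp
  | hs c x _ hx => rw [mul_smul_comm, map_smul, hx]; split_ifs <;> simp
  | hw w _ => rw [← wd_cons, leftDiv_wd_cons]

/-- Left division sees only the first letter, so it respects any condition imposed on the remaining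
ones. Applied to each term of the intersection, it shows that stripping a letter from `W_{n+1}`
lands in `W_n`, without having to commute tensor products and intersections. -/
theorem leftDiv_mem (s : S) {X : Submodule k (TensorAlgebra k V)} {t : TensorAlgebra k V}
    (ht : t ∈ LinearMap.range (TensorAlgebra.ι k (M := V)) * X) : leftDiv b s t ∈ X := by
  refine (Submodule.mul_le (P := X.comap (leftDiv b s))).2 (fun v hv x hx => ?_) ht
  rw [range_ι_eq b] at hv
  induction hv using spanW_induction with
  | h0 => simp
  | hadd x x' _ _ hx hx' => rw [add_mul]; exact add_mem hx hx'
  | hs c x _ hx => rw [smul_mul_assoc]; exact Submodule.smul_mem _ _ hx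
  | hw w hw =>
    obtain ⟨c, rfl⟩ := List.length_eq_one_iff.1 hw
    rw [Submodule.mem_comap, wd_singleton, leftDiv_ι_mul]
    split_ifs
    exacts [hx, zero_mem _]

variable (b) in
theorem exists_eq_sum_leftDiv {n : ℕ} {t : TensorAlgebra k V}
    (ht : t ∈ LinearMap.range (TensorAlgebra.ι k (M := V)) ^ (n + 1)) :
    ∃ F : Finset S, t = ∑ s ∈ F, TensorAlgebra.ι k (b s) * leftDiv b s t := by
  classical
  suffices h : ∃ F : Finset S, ∀ F', F ⊆ F' →
      t = ∑ s ∈ F', TensorAlgebra.ι k (b s) * leftDiv b s t from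
    h.imp fun F hF => hF F subset_rfl
  rw [range_ι_pow b] at ht
  induction ht using spanW_induction with
  | h0 => exact ⟨∅, by simp⟩
  | hadd x y _ _ hx hy =>
    obtain ⟨F, hF⟩ := hx
    obtain ⟨G, hG⟩ := hy
    refine ⟨F ∪ G, fun H hH => ?_⟩
    simp only [map_add, mul_add, Finset.sum_add_distrib]
    rw [← hF H (Finset.union_subset_left hH), ← hG H (Finset.union_subset_right hH)]
  | hs c x _ hx =>
    obtain ⟨F, hF⟩ := hx
    refine ⟨F, fun H hH => ?_⟩
    simp only [map_smul, mul_smul_comm, ← Finset.smul_sum]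
    rw [← hF H hH]
  | hw w hw =>
    obtain ⟨c, w, rfl⟩ := List.exists_cons_of_length_eq_add_one hw
    refine ⟨{c}, fun H hH => ?_⟩
    rw [Finset.singleton_subset_iff] at hH
    simp only [leftDiv_wd_cons, mul_ite, mul_zero]
    rw [Finset.sum_ite_eq H c]
    simp [hH, wd_cons]

theorem leftDiv_mem_dualComponent {n : ℕ} {t : TensorAlgebra k V}
    (ht : t ∈ dualComponent η (n + 1)) (s : S) : leftDiv b s t ∈ dualComponent η n := by
  refine ⟨leftDiv_mem s (by rw [← pow_succ']; exact ht.1), ?_⟩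
  simp only [SetLike.mem_coe, Submodule.mem_iInf]
  intro i j hij
  apply leftDiv_mem
  rw [← mul_assoc, ← mul_assoc, ← pow_succ']
  have := ht.2
  simp only [SetLike.mem_coe, Submodule.mem_iInf] at this
  exact this (i + 1) j (by omega)

variable (b) in
include b in
theorem differential_mem_complexTerm {n : ℕ} {z : A ⊗[k] TensorAlgebra k V}
    (hz : z ∈ complexTerm η (n + 1)) : differential η z ∈ complexTerm η n := by
  refine complexTerm_induction (P := (complexTerm η n).comap (differential η))
    (fun a t ht => ?_) hz
  obtain ⟨F, hF⟩ := exists_eq_sum_leftDiv b ht.1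
  rw [hF, TensorProduct.tmul_sum]
  refine sum_mem fun s _ => ?_
  rw [Submodule.mem_comap, differential_tmul_ι_mul]
  exact tmul_mem_complexTerm _ (leftDiv_mem_dualComponent ht s)

variable (b) in
include b in
theorem differential_differential_tmul {r : TensorAlgebra k V}
    (hr : r ∈ LinearMap.range (TensorAlgebra.ι k (M := V)) ^ 2) (a : A) (y : TensorAlgebra k V) :
    differential η (differential η (a ⊗ₜ[k] (r * y))) =
      (a * TensorAlgebra.lift k η r) ⊗ₜ[k] y := by
  rw [range_ι_pow b] at hr
  induction hr using spanW_induction with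
  | h0 => simp
  | hadd x x' _ _ hx hx' =>
    simp only [add_mul, TensorProduct.tmul_add, map_add, hx, hx', mul_add, TensorProduct.add_tmul]
  | hs c x _ hx =>
    simp only [smul_mul_assoc, TensorProduct.tmul_smul, map_smul, hx, mul_smul_comm,
      ← TensorProduct.smul_tmul']
  | hw w hw =>
    obtain ⟨p, q, rfl⟩ := List.length_eq_two.1 hw
    simp only [wd_cons, wd_nil, mul_one, mul_assoc, differential_tmul_ι_mul, map_mul,
      TensorAlgebra.lift_ι_apply]

-- Two steps of the differential multiply the first two letters into `A`, and for elements of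
-- `W_{n+2}` those letters form a relation.
variable (b) in
include b in
theorem differential_differential_eq_zero {n : ℕ} {z : A ⊗[k] TensorAlgebra k V}
    (hz : z ∈ complexTerm η (n + 2)) : differential η (differential η z) = 0 := by
  refine complexTerm_induction (P := LinearMap.ker ((differential η).comp (differential η)))
    (fun a t ht => ?_) hz
  have := ht.2
  simp only [SetLike.mem_coe, Submodule.mem_iInf] at this
  have := this 0 n (by omega)
  rw [pow_zero, one_mul] at this
  refine (Submodule.mul_le (P := (LinearMap.ker ((differential η).comp (differential η))).comap
    (TensorProduct.mk k A (TensorAlgebra k V) a))).2 (fun r hr y _ => ?_) this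
  have h0 : TensorAlgebra.lift k η r = 0 := by simpa using hr.2
  simp [differential_differential_tmul b hr.1, h0]

variable [LinearOrder S] {good : S → S → Prop}

/-- The normal form operator acting on the letters at the positions `i` and `i + 1`. -/
noncomputable def IsPBW.normalFormAt [WellFoundedLT S] (h : IsPBW b η good) (i : ℕ) :
    TensorAlgebra k V →ₗ[k] TensorAlgebra k V :=
  (wordBasis b).constr k fun w => wd b (w.take i) *
    (h.normalForm (wd b ((w.drop i).take 2)) * wd b (w.drop (i + 2)))

theorem IsPBW.normalFormAt_wd [WellFoundedLT S] (h : IsPBW b η good) {i : ℕ} {x r y : List S}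
    (hx : x.length = i) (hr : r.length = 2) : h.normalFormAt i (wd b (x ++ (r ++ y))) =
      wd b x * (h.normalForm (wd b r) * wd b y) := by
  subst hx
  rw [IsPBW.normalFormAt, ← wordBasis_apply, Basis.constr_basis]
  have e : (x ++ (r ++ y)).drop (x.length + 2) = y := by
    rw [← List.append_assoc, List.drop_left' (by simp [hr])]
  rw [e, List.take_left' rfl, List.drop_left' rfl, List.take_left' hr]

theorem IsPBW.normalFormAt_mul [WellFoundedLT S] (h : IsPBW b η good) {i : ℕ}
    {x r : TensorAlgebra k V} (hx : x ∈ spanW b {w | w.length = i})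
    (hr : r ∈ spanW b {w | w.length = 2}) (y : TensorAlgebra k V) :
    h.normalFormAt i (x * (r * y)) = x * (h.normalForm r * y) := by
  have hy : y ∈ spanW b Set.univ := by rw [spanW_univ]; trivial
  induction hx using spanW_induction with
  | h0 => simp
  | hadd x x' _ _ hx hx' => simp only [add_mul, map_add, hx, hx']
  | hs c x _ hx => simp only [smul_mul_assoc, map_smul, hx]
  | hw x0 hx =>
    induction hr using spanW_induction with
    | h0 => simp
    | hadd x x' _ _ hx hx' => simp only [add_mul, mul_add, map_add, hx, hx']
    | hs c x _ hx => simp only [smul_mul_assoc, mul_smul_comm, map_smul, hx]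
    | hw r0 hr =>
      induction hy using spanW_induction with
      | h0 => simp
      | hadd x x' _ _ hx hx' => simp only [mul_add, map_add, hx, hx']
      | hs c x _ hx => simp only [mul_smul_comm, map_smul, hx]
      | hw y0 _ => rw [← wd_append, ← wd_append, h.normalFormAt_wd hx hr]

/-- The normal form of an element depends only on its image in `A`, so it kills every relation.
Membership in `W_n` can thus be tested by linear operators, one for each position. -/
theorem IsPBW.normalFormAt_eq_zero [WellFoundedLT S] (h : IsPBW b η good) {i j : ℕ}
    {t : TensorAlgebra k V} (ht : t ∈ LinearMap.range (TensorAlgebra.ι k (M := V)) ^ i *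
      relations η * LinearMap.range (TensorAlgebra.ι k (M := V)) ^ j) :
    h.normalFormAt i t = 0 := by
  have hle : LinearMap.range (TensorAlgebra.ι k (M := V)) ^ i *
      relations η * LinearMap.range (TensorAlgebra.ι k (M := V)) ^ j ≤
      LinearMap.ker (h.normalFormAt i) := by
    rw [mul_assoc, Submodule.mul_le]
    intro x hx q hq
    refine (Submodule.mul_le (P := (LinearMap.ker (h.normalFormAt i)).comap
      (LinearMap.mulLeft k x))).2 (fun r hr y _ => ?_) hq
    rw [range_ι_pow b] at hx
    have hr1 := hr.1
    rw [SetLike.mem_coe, range_ι_pow b] at hr1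
    have h0 : h.normalForm r = h.normalForm 0 := h.normalForm_congr (by simpa using hr.2)
    simp [h.normalFormAt_mul hx hr1, h0]
  exact hle ht

theorem IsPBW.normalFormAt_wd_mem [WellFoundedLT S] (h : IsPBW b η good) {i : ℕ}
    {w : List S} (hi : i + 2 ≤ w.length) {Q : Set (List S)} (hQ : LowerClosed Q) (hw : w ∈ Q) :
    h.normalFormAt i (wd b w) ∈ spanW b Q := by
  obtain ⟨x, r, y, rfl, hx, hr⟩ : ∃ x r y, w = x ++ (r ++ y) ∧ x.length = i ∧ r.length = 2 :=
    ⟨w.take i, (w.drop i).take 2, (w.drop i).drop 2, by simp, by simp; omega, by simp; omega⟩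
  rw [h.normalFormAt_wd hx hr]
  by_cases hg : r.IsChain good
  · rw [h.normalForm_wd hg, ← wd_append, ← wd_append]
    exact wd_mem_spanW b hw
  · exact wd_mul_spanW_mul x y (fun w' hw' => hQ hw ((hw'.append_right y).append_left x))
      (h.normalForm_wd_mem hg)

/-- The leading word of an element of a term of the Koszul complex has bad pairs only. -/
theorem IsPBW.leading_isChain [WellFoundedLT S] (h : IsPBW b η good) {n : ℕ}
    {z : A ⊗[k] TensorAlgebra k V} (hz : z ∈ complexTerm η n) {u w : List S}
    (hu : u.IsChain good) (hw : w.length = n) {c : k} (hc : c ≠ 0)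
    (hlead : z - c • tw b η u w ∈ Sp b η n {y | List.Shortlex (· < ·) y (u ++ w)}) :
    w.IsChain (fun a c => ¬ good a c) := by
  by_contra hbad
  obtain ⟨x, a, c', y, rfl, hac⟩ := exists_of_not_isChain hbad
  rw [not_not] at hac
  -- If `w` contained a good pair, the operator at its position would fix `u ⊗ w` and never raise
  -- other words, yet it kills `z`. Then `c • (u ⊗ w)` would be a combination of smaller words,
  -- which is impossible for `c ≠ 0`.
  have hker : complexTerm η n ≤ LinearMap.ker ((h.normalFormAt x.length).lTensor A) := by
    refine complexTerm_induction fun a t ht => ?_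
    have := (Submodule.mem_iInf _).1 ht.2 x.length
    have := (Submodule.mem_iInf _).1 this y.length
    have := (Submodule.mem_iInf _).1 this (by rw [← hw]; simp; omega)
    rw [LinearMap.mem_ker, LinearMap.lTensor_tmul, h.normalFormAt_eq_zero this,
      TensorProduct.tmul_zero]
  have hSp : ∀ Q : Set (List S), LowerClosed Q → Sp b η n Q ≤
      (Sp b η n Q).comap ((h.normalFormAt x.length).lTensor A) := by
    intro Q hQ
    rw [Sp, Submodule.span_le]
    rintro _ ⟨u', w', hw', hQ', rfl⟩
    rw [SetLike.mem_coe, Submodule.mem_comap, tw, LinearMap.lTensor_tmul]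
    refine tmul_mem_Sp b η u' (Q := {y | y.length = n ∧ u' ++ y ∈ Q})
      (h.normalFormAt_wd_mem ?_ ?_ ⟨hw', hQ'⟩) (fun w hw => hw.1) (fun w hw => hw.2)
    · rw [hw', ← hw]; simp
    · exact fun p q hp hq => ⟨hq.1.trans hp.1, hQ hp.2 (hq.append_left u')⟩
  have h1 := hSp _ (lowerClosed_shortlex _) hlead
  rw [Submodule.mem_comap, map_sub, map_smul, LinearMap.mem_ker.1 (hker hz), zero_sub, tw,
    LinearMap.lTensor_tmul, h.normalFormAt_wd rfl rfl, h.normalForm_wd (by simpa using hac),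
    ← wd_append, ← wd_append, ← neg_smul] at h1
  have := h.eq_zero_of_smul_tw_mem (lowerClosed_shortlex _) hu (shortlex_irrefl _) h1
  exact hc (neg_eq_zero.1 this)

end

end Koszul

namespace Koszul

open Module

/-! ### Exactness from the existence of dual words -/

section

variable {k : Type u} [Field k] {V : Type v} [AddCommGroup V] [Module k V]
variable {A : Type w} [Ring A] [Algebra k A]
variable {S : Type*} [LinearOrder S]
variable {b : Basis S k V} {η : V →ₗ[k] A} {good : S → S → Prop}

variable (b η good) in
/-- Every word of length `n` with bad pairs only is the leading word of an element of the component
of weight `n` of the Koszul dual coalgebra. -/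
def HasDualWords (n : ℕ) : Prop :=
  ∀ w : List S, w.IsChain (fun a c => ¬ good a c) → w.length = n →
    ∃ t ∈ dualComponent η n, t - wd b w ∈ spanW b {y | Lower y w}

/-- The leading word of a cycle can be cut one letter further left: the boundary of `u' ⊗ t`, with
`t` led by `p :: s :: w`, has the same leading term as `z`. -/
theorem IsPBW.exists_cancel [WellFoundedLT S] (h : IsPBW b η good) {n : ℕ}
    (hD : HasDualWords b η good (n + 2)) {Q : Set (List S)} (hQ : LowerClosed Q)
    {z : A ⊗[k] TensorAlgebra k V} (hz : z ∈ complexTerm η (n + 1))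
    (hd : differential η z = 0) (hzQ : z ∈ Sp b η (n + 1) Q) (hz0 : z ≠ 0) :
    ∃ x ∈ Q, ∃ g ∈ complexTerm η (n + 2) ⊓ Sp b η (n + 2) Q,
      z - differential η g ∈ Sp b η (n + 1) (Q ∩ {y | List.Shortlex (· < ·) y x}) := by
  obtain ⟨u, w, c, hu, hw, hc, hx, hlead⟩ := h.exists_leading hQ hzQ hz0
  have hlead' := Sp_mono b η Set.inter_subset_right hlead
  have hbad := h.leading_isChain hz hu hw hc hlead'
  obtain ⟨s, w, rfl⟩ := List.exists_cons_of_length_eq_add_one hw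
  -- In the good case the differential of the leading term is again a basis element, larger than
  -- everything else in the differential of `z`, which is zero.
  by_cases hus : (u ++ [s]).IsChain good
  · have h1 := differential_mem_Sp b η hlead'
    rw [map_sub, map_smul, hd, zero_sub, differential_tw_cons, ← neg_smul] at h1
    have := h.eq_zero_of_smul_tw_mem (lowerClosed_shortlex _) hus
      (by simpa using shortlex_irrefl (u ++ s :: w)) h1
    exact absurd (neg_eq_zero.1 this) hc
  -- The word `u` is not empty, as a single letter contains no bad pair; as `u` itself is good, the
  -- bad pair straddles the junction with `s`.
  · obtain ⟨u, p, rfl, hps⟩ : ∃ u' p, u = u' ++ [p] ∧ ¬ good p s := by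
      rcases u.eq_nil_or_concat with rfl | ⟨u', p, rfl⟩
      · simp at hus
      · refine ⟨u', p, by simp, fun hg => hus ?_⟩
        rw [List.isChain_append]
        refine ⟨hu, by simp, fun x hx y hy => ?_⟩
        simp_all
    obtain ⟨t, ht, htw⟩ := hD (p :: s :: w) (List.isChain_cons_cons.2 ⟨hps, hbad⟩)
      (by simpa using hw)
    have hlen : (p :: s :: w).length = n + 2 := by simpa using hw
    have hdec : TensorAlgebra.lift k η (wd b u) ⊗ₜ[k] t = tw b η u (p :: s :: w) +
        TensorAlgebra.lift k η (wd b u) ⊗ₜ[k] (t - wd b (p :: s :: w)) := by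
      rw [tw, ← TensorProduct.tmul_add, add_sub_cancel]
    have hrest : TensorAlgebra.lift k η (wd b u) ⊗ₜ[k] (t - wd b (p :: s :: w)) ∈
        Sp b η (n + 2) {y | Lower y (u ++ p :: s :: w)} :=
      tmul_mem_Sp b η u htw (fun y hy => hy.1.trans hlen) (fun y hy => hy.append_left u)
    have hx' : u ++ p :: s :: w ∈ Q := by simpa using hx
    have hsub : {y | Lower y (u ++ p :: s :: w)} ⊆
        Q ∩ {y | List.Shortlex (· < ·) y (u ++ [p] ++ s :: w)} := fun y hy =>
      ⟨hQ hx' hy, by simpa using hy.shortlex⟩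
    refine ⟨_, hx, c • (TensorAlgebra.lift k η (wd b u) ⊗ₜ[k] t), ⟨?_, ?_⟩, ?_⟩
    · exact Submodule.smul_mem _ _ (tmul_mem_complexTerm _ ht)
    · refine Submodule.smul_mem _ _ ?_
      rw [hdec]
      exact add_mem (tw_mem_Sp b η hlen hx')
        (Sp_mono b η (hsub.trans Set.inter_subset_left) hrest)
    · rw [map_smul, hdec, map_add, differential_tw_cons, smul_add, ← sub_sub]
      exact sub_mem hlead (Submodule.smul_mem _ _
        (differential_mem_Sp b η (Sp_mono b η hsub hrest)))

/-- Exactness of the Koszul complex, with control of the words that occur. -/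
theorem IsPBW.mem_map_differential [WellFoundedLT S] (h : IsPBW b η good) {n : ℕ}
    (hD : HasDualWords b η good (n + 2)) {Q : Set (List S)} (hQ : LowerClosed Q)
    {z : A ⊗[k] TensorAlgebra k V} (hz : z ∈ complexTerm η (n + 1))
    (hd : differential η z = 0) (hzQ : z ∈ Sp b η (n + 1) Q) :
    z ∈ (complexTerm η (n + 2) ⊓ Sp b η (n + 2) Q).map (differential η) := by
  -- The induction runs over a strict shortlex bound `x` for the words that occur. `Q` itself need
  -- not be bounded; a first cancellation outside the induction supplies the bound.
  have step : ∀ x : List S, ∀ Q' ⊆ Q, LowerClosed Q' →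
      Q' ⊆ {y | List.Shortlex (· < ·) y x} → ∀ z ∈ complexTerm η (n + 1),
      differential η z = 0 → z ∈ Sp b η (n + 1) Q' →
      z ∈ (complexTerm η (n + 2) ⊓ Sp b η (n + 2) Q).map (differential η) := by
    intro x
    induction x using (List.Shortlex.wf (r := ((· < ·) : S → S → Prop))
      wellFounded_lt).induction with
    | _ x ih =>
      intro Q' hQQ hQ' hx z hz hd hzQ
      by_cases hz0 : z = 0
      · exact hz0 ▸ zero_mem _
      obtain ⟨x', hx', g, hg, hzg⟩ := h.exists_cancel hD hQ' hz hd hzQ hz0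
      have hg' : differential η g ∈
          (complexTerm η (n + 2) ⊓ Sp b η (n + 2) Q).map (differential η) :=
        ⟨g, ⟨hg.1, Sp_mono b η hQQ hg.2⟩, rfl⟩
      rw [← sub_add_cancel z (differential η g)]
      refine add_mem (ih x' (hx hx') _ (Set.inter_subset_left.trans hQQ)
        (hQ'.inter (lowerClosed_shortlex _)) Set.inter_subset_right _
        (sub_mem hz (differential_mem_complexTerm b hg.1)) ?_ hzg) hg'
      rw [map_sub, hd, differential_differential_eq_zero b hg.1, sub_zero]
  by_cases hz0 : z = 0
  · exact hz0 ▸ zero_mem _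
  obtain ⟨x', hx', g, hg, hzg⟩ := h.exists_cancel hD hQ hz hd hzQ hz0
  rw [← sub_add_cancel z (differential η g)]
  refine add_mem (step x' _ Set.inter_subset_left
    (hQ.inter (lowerClosed_shortlex _)) Set.inter_subset_right _
    (sub_mem hz (differential_mem_complexTerm b hg.1)) ?_ hzg) ⟨g, hg, rfl⟩
  rw [map_sub, hd, differential_differential_eq_zero b hg.1, sub_zero]

end

end Koszul

namespace Koszul

open Module

/-! ### Construction of the dual words, and Priddy's criterion -/

section

variable {k : Type u} [Field k] {V : Type v} [AddCommGroup V] [Module k V]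
variable {A : Type w} [Ring A] [Algebra k A]
variable {S : Type*} (b : Basis S k V) {η : V →ₗ[k] A}

-- On products, `D` is `φ ⊗ id`. Over a field everything is flat: the kernel of `φ ⊗ id` on `M ⊗ X`
-- is `ker φ ⊗ X`, and nothing is lost when `X` is replaced by the tensor algebra.
omit b in
theorem mem_inf_ker_mul {M X : Submodule k (TensorAlgebra k V)} (φ : TensorAlgebra k V →ₗ[k] A)
    (D : TensorAlgebra k V →ₗ[k] A ⊗[k] TensorAlgebra k V)
    (hD : ∀ r ∈ M, ∀ y, D (r * y) = φ r ⊗ₜ[k] y) {t : TensorAlgebra k V}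
    (ht : t ∈ M * X) (h0 : D t = 0) : t ∈ (M ⊓ LinearMap.ker φ) * X := by
  rw [← Submodule.mulMap_range] at ht
  obtain ⟨q, rfl⟩ := ht
  have e : ∀ q, D (M.mulMap X q) = X.subtype.lTensor A ((φ.comp M.subtype).rTensor X q) := by
    intro q
    induction q with
    | zero => simp
    | add x y hx hy => simp only [map_add, hx, hy]
    | tmul r y =>
      rw [Submodule.mulMap_tmul, hD _ r.2]
      simp
  rw [e] at h0
  have h1 : (φ.comp M.subtype).rTensor X q = 0 :=
    Module.Flat.lTensor_preserves_injective_linearMap (M := A) X.subtype X.injective_subtype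
      (h0.trans (map_zero _).symm)
  have hex : Function.Exact ((LinearMap.ker (φ.comp M.subtype)).subtype.rTensor X)
      ((φ.comp M.subtype).rTensor X) :=
    Module.Flat.rTensor_exact X (LinearMap.exact_subtype_ker_map _)
  obtain ⟨q', rfl⟩ := (hex q).1 h1
  clear h0 h1 e
  induction q' with
  | zero => simp
  | add x y hx hy => simp only [map_add]; exact add_mem hx hy
  | tmul r y =>
    rw [LinearMap.rTensor_tmul, Submodule.mulMap_tmul]
    exact Submodule.mul_mem_mul ⟨r.1.2, r.2⟩ y.2

include b in
theorem mem_relations_mul {X : Submodule k (TensorAlgebra k V)} {t : TensorAlgebra k V}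
    (ht : t ∈ LinearMap.range (TensorAlgebra.ι k (M := V)) ^ 2 * X)
    (h0 : differential η (differential η ((1 : A) ⊗ₜ[k] t)) = 0) : t ∈ relations η * X := by
  refine mem_inf_ker_mul (TensorAlgebra.lift k η).toLinearMap ((differential η).comp
    ((differential η).comp (TensorProduct.mk k A (TensorAlgebra k V) 1))) (fun r hr y => ?_) ht h0
  have := differential_differential_tmul (η := η) b hr 1 y
  rw [one_mul] at this
  exact this

variable {b} [LinearOrder S] {good : S → S → Prop}

/-- In weight two the element sought is the rewriting relation of the bad pair. -/
theorem IsPBW.hasDualWords_two (h : IsPBW b η good) : HasDualWords b η good 2 := by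
  intro w hw hlen
  obtain ⟨a, c, rfl⟩ := List.length_eq_two.1 hlen
  obtain ⟨p, hp, hr⟩ := h.exists_relation (show ¬ good a c by simpa using hw)
  refine ⟨_, ⟨hr.1, ?_⟩, ?_⟩
  · simp only [SetLike.mem_coe, Submodule.mem_iInf]
    intro i j hij
    obtain rfl : i = 0 := by omega
    obtain rfl : j = 0 := by omega
    simpa using hr
  · rw [sub_sub_cancel_left]
    exact neg_mem hp

/-- The projection of a PBW algebra onto the generators. -/
noncomputable def IsPBW.toGenerators [WellFoundedLT S] (h : IsPBW b η good) :
    A →ₗ[k] TensorAlgebra k V :=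
  h.basis.constr k fun u => if u.1.length = 1 then wd b u.1 else 0

theorem IsPBW.toGenerators_lift [WellFoundedLT S] (h : IsPBW b η good) (s : S) :
    h.toGenerators (TensorAlgebra.lift k η (wd b [s])) = wd b [s] := by
  have := h.basis_apply ⟨[s], by simp⟩
  simp only at this
  simp [IsPBW.toGenerators, ← this, Basis.constr_basis]

theorem IsPBW.toGenerators_mem [WellFoundedLT S] (h : IsPBW b η good) (a : A) :
    h.toGenerators a ∈ LinearMap.range (TensorAlgebra.ι k (M := V)) := by
  have : LinearMap.range h.toGenerators ≤ LinearMap.range (TensorAlgebra.ι k (M := V)) := by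
    rw [IsPBW.toGenerators, Basis.constr_range, Submodule.span_le]
    rintro _ ⟨u, rfl⟩
    rw [range_ι_eq b]
    dsimp only
    split_ifs with hu
    · exact wd_mem_spanW b hu
    · exact zero_mem _
  exact this ⟨a, rfl⟩

/-- The map `A ⊗ T(V) → T(V)` that multiplies the generators in `A` with the words. -/
noncomputable def IsPBW.unsplit [WellFoundedLT S] (h : IsPBW b η good) :
    A ⊗[k] TensorAlgebra k V →ₗ[k] TensorAlgebra k V :=
  (LinearMap.mul' k (TensorAlgebra k V)).comp (h.toGenerators.rTensor (TensorAlgebra k V))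

theorem IsPBW.unsplit_tmul [WellFoundedLT S] (h : IsPBW b η good) (a : A)
    (t : TensorAlgebra k V) : h.unsplit (a ⊗ₜ[k] t) = h.toGenerators a * t := by
  simp [IsPBW.unsplit]

/-- When the total length is `n + 1`, the factor in `A` is a single generator, which is not lost in
passing to `A`; on such elements `unsplit` inverts `t ↦ differential η (1 ⊗ t)`. -/
theorem IsPBW.unsplit_mem [WellFoundedLT S] (h : IsPBW b η good) {n : ℕ} {Q : Set (List S)}
    (hQ : ∀ y ∈ Q, y.length = n + 1) {q : A ⊗[k] TensorAlgebra k V} (hq : q ∈ Sp b η n Q) :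
    h.unsplit q ∈ spanW b Q ∧ differential η (1 ⊗ₜ[k] h.unsplit q) = q := by
  have hle : Sp b η n Q ≤ (spanW b Q).comap h.unsplit ⊓
      LinearMap.eqLocus ((differential η).comp
        ((TensorProduct.mk k A (TensorAlgebra k V) 1).comp h.unsplit)) LinearMap.id := by
    rw [Sp, Submodule.span_le]
    rintro _ ⟨u, w, hw, hu, rfl⟩
    have hu1 : u.length = 1 := by
      have := hQ _ hu
      rw [List.length_append] at this
      omega
    obtain ⟨s, rfl⟩ := List.length_eq_one_iff.1 hu1
    have e : h.unsplit (tw b η [s] w) = wd b (s :: w) := by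
      rw [tw, h.unsplit_tmul, h.toGenerators_lift, ← wd_append]
      rfl
    refine ⟨?_, ?_⟩
    · rw [SetLike.mem_coe, Submodule.mem_comap, e]
      exact wd_mem_spanW b hu
    · simp only [SetLike.mem_coe, LinearMap.mem_eqLocus, LinearMap.comp_apply, e,
        TensorProduct.mk_apply, LinearMap.id_apply]
      rw [wd_cons, differential_tmul_ι_mul, tw, wd_singleton, TensorAlgebra.lift_ι_apply, one_mul]
  exact hle hq

theorem IsPBW.unsplit_mem_mul [WellFoundedLT S] (h : IsPBW b η good) {n : ℕ}
    {q : A ⊗[k] TensorAlgebra k V} (hq : q ∈ complexTerm η n) {i j : ℕ} (hij : i + 2 + j = n) :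
    h.unsplit q ∈ LinearMap.range (TensorAlgebra.ι k (M := V)) ^ (i + 1) * relations η *
      LinearMap.range (TensorAlgebra.ι k (M := V)) ^ j := by
  refine complexTerm_induction (P := Submodule.comap h.unsplit
    (LinearMap.range (TensorAlgebra.ι k (M := V)) ^ (i + 1) * relations η *
      LinearMap.range (TensorAlgebra.ι k (M := V)) ^ j)) (fun a t ht => ?_) hq
  have := ht.2
  simp only [SetLike.mem_coe, Submodule.mem_iInf] at this
  rw [Submodule.mem_comap, h.unsplit_tmul, pow_succ', mul_assoc, mul_assoc, ← mul_assoc _ _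
    (LinearMap.range (TensorAlgebra.ι k (M := V)) ^ j)]
  exact Submodule.mul_mem_mul (h.toGenerators_mem a) (this i j hij)

/-- With `t` the element led by `c :: w`, the tensor `a ⊗ t` has the right leading word but need not
be a cycle. Its boundary involves smaller words only, hence by exactness one degree lower it is the
boundary of some `g` with smaller words. Then `a ⊗ t - g` is a cycle in `V ⊗ W_{m+2}`, and a cycle
there lies in `W_{m+3}`. This is why exactness has to keep track of the set `Q`. -/
theorem IsPBW.hasDualWords_succ [WellFoundedLT S] (h : IsPBW b η good) {m : ℕ}
    (hD : HasDualWords b η good (m + 2)) : HasDualWords b η good (m + 3) := by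
  intro w hw hlen
  obtain ⟨a, w, rfl⟩ := List.exists_cons_of_length_eq_add_one hlen
  obtain ⟨c, w, rfl⟩ := List.exists_cons_of_length_eq_add_one
    (show w.length = (m + 1) + 1 by simpa using hlen)
  obtain ⟨hac, hcw⟩ := List.isChain_cons_cons.1 hw
  have hlen' : (c :: w).length = m + 2 := by simpa using hlen
  obtain ⟨t, ht, htw⟩ := hD _ hcw hlen'
  set Q : Set (List S) := {y | Lower y (a :: c :: w)} with hQdef
  have hQ : LowerClosed Q := lowerClosed_lower _
  have hQlen : ∀ y ∈ Q, y.length = (m + 2) + 1 := fun y hy => hy.1.trans hlen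
  have hy : TensorAlgebra.lift k η (wd b [a]) ⊗ₜ[k] t - tw b η [a] (c :: w) ∈
      Sp b η (m + 2) Q := by
    rw [tw, ← TensorProduct.tmul_sub]
    exact tmul_mem_Sp b η [a] htw (fun y hy => hy.1.trans hlen') (fun y hy => hy.append_left [a])
  have hyK := tmul_mem_complexTerm (TensorAlgebra.lift k η (wd b [a])) ht
  set y' := TensorAlgebra.lift k η (wd b [a]) ⊗ₜ[k] t
  -- The expected leading term `ac ⊗ w` drops, because `ac` is bad and rewrites to smaller words.
  have hdy : differential η y' ∈ Sp b η (m + 1) Q := by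
    have h1 := differential_mem_Sp b η hy
    rw [map_sub, differential_tw_cons] at h1
    have h2 : tw b η ([a] ++ [c]) w ∈ Sp b η (m + 1) Q := by
      rw [h.Sp_eq _ hQ]
      exact h.tmul_wd_mem_Sp (by simpa using hlen') (fun y hy => hy) (by simpa using hac)
    simpa using add_mem h1 h2
  obtain ⟨g, ⟨hgK, hgQ⟩, hg⟩ := h.mem_map_differential hD hQ
    (differential_mem_complexTerm b hyK) (differential_differential_eq_zero b hyK) hdy
  have hqK : y' - g ∈ complexTerm η (m + 2) := sub_mem hyK hgK
  have hd : differential η (y' - g) = 0 := by rw [map_sub, hg, sub_self]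
  have hq : y' - g - tw b η [a] (c :: w) ∈ Sp b η (m + 2) Q := by
    rw [sub_right_comm]
    exact sub_mem hy hgQ
  have htw' : tw b η [a] (c :: w) ∈ Sp b η (m + 2) {y : List S | y.length = m + 2 + 1} :=
    tw_mem_Sp b η hlen' hlen
  have hq' : y' - g ∈ Sp b η (m + 2) {y : List S | y.length = m + 2 + 1} := by
    rw [← sub_add_cancel (y' - g) (tw b η [a] (c :: w))]
    exact add_mem (Sp_mono b η hQlen hq) htw'
  obtain ⟨h1, h2⟩ := h.unsplit_mem (fun y hy => hy) hq'
  refine ⟨h.unsplit (y' - g), ⟨?_, ?_⟩, ?_⟩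
  · rw [range_ι_pow b]
    exact h1
  · simp only [SetLike.mem_coe, Submodule.mem_iInf]
    intro i j hij
    -- Relations at positions at least one come from `t` and `g` lying in `A ⊗ W_{m+2}`. The
    -- relation at position zero is the cycle condition.
    cases i with
    | zero =>
      obtain rfl : j = m + 1 := by omega
      rw [pow_zero, one_mul]
      refine mem_relations_mul b ?_ (by rw [h2, hd])
      rw [← pow_add, range_ι_pow b, show 2 + (m + 1) = m + 2 + 1 by omega]
      exact h1
    | succ i => exact h.unsplit_mem_mul hqK (by omega)
  · have := (h.unsplit_mem hQlen hq).1
    rw [map_sub, tw, h.unsplit_tmul, h.toGenerators_lift, ← wd_append] at this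
    exact this

theorem IsPBW.hasDualWords [WellFoundedLT S] (h : IsPBW b η good) (m : ℕ) :
    HasDualWords b η good (m + 2) := by
  induction m with
  | zero => exact h.hasDualWords_two
  | succ m ih => exact h.hasDualWords_succ ih

theorem IsPBW.complexTerm_le [WellFoundedLT S] (h : IsPBW b η good) (n : ℕ) :
    complexTerm η n ≤ Sp b η n {y | n ≤ y.length} := by
  refine complexTerm_induction fun a t ht => ?_
  have ht1 := ht.1
  rw [SetLike.mem_coe, range_ι_pow b] at ht1
  obtain ⟨x, rfl⟩ := h.surjective a
  have hx : x ∈ spanW b Set.univ := by rw [spanW_univ]; trivial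
  induction hx using spanW_induction with
  | h0 => simp
  | hadd x x' _ _ hx hx' => rw [map_add, TensorProduct.add_tmul]; exact add_mem hx hx'
  | hs c x _ hx =>
    rw [map_smul, ← TensorProduct.smul_tmul']
    exact Submodule.smul_mem _ _ hx
  | hw w _ =>
    refine tmul_mem_Sp b η w ht1 (fun w hw => hw) fun w' hw' => ?_
    have : w'.length = n := hw'
    simp [this]

theorem IsPBW.koszulComplexAcyclic [WellFoundedLT S] (h : IsPBW b η good) :
    KoszulComplexAcyclic η := by
  have hone : (1 : A) ⊗ₜ[k] (1 : TensorAlgebra k V) = tw b η [] [] := by simp [tw]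
  refine ⟨⟨?_, le_antisymm (sup_le ?_ ?_) ?_⟩, fun n => le_antisymm ?_ ?_⟩
  · rw [Submodule.disjoint_def]
    rintro x hx ⟨z, hz, rfl⟩
    obtain ⟨c, hc⟩ := Submodule.mem_span_singleton.1 hx
    have h1 := differential_mem_Sp b η (h.complexTerm_le 1 hz)
    rw [hone] at hc
    rw [← hc] at h1 ⊢
    -- Boundaries in degree zero involve words of length at least one, whereas `1 ⊗ 1` is the empty
    -- word.
    rw [h.eq_zero_of_smul_tw_mem (fun x y hx hy => ?_) (by simp) (by simp) h1, zero_smul]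
    exact (show 1 ≤ x.length from hx).trans hy.1.ge
  · rw [Submodule.span_singleton_le_iff_mem]
    refine tmul_mem_complexTerm _ ⟨by simp, ?_⟩
    simp only [SetLike.mem_coe, Submodule.mem_iInf]
    intro i j hij
    omega
  · rintro _ ⟨z, hz, rfl⟩
    exact differential_mem_complexTerm b hz
  · refine complexTerm_induction fun a t ht => ?_
    have ht1 := ht.1
    rw [SetLike.mem_coe, pow_zero, Submodule.mem_one] at ht1
    obtain ⟨c, rfl⟩ := ht1
    rw [Algebra.algebraMap_eq_smul_one, TensorProduct.tmul_smul]
    refine Submodule.smul_mem _ _ ?_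
    obtain ⟨x, rfl⟩ := h.surjective a
    have hx : x ∈ spanW b Set.univ := by rw [spanW_univ]; trivial
    induction hx using spanW_induction with
    | h0 => simp
    | hadd x x' _ _ hx hx' => rw [map_add, TensorProduct.add_tmul]; exact add_mem hx hx'
    | hs c x _ hx =>
      rw [map_smul, ← TensorProduct.smul_tmul']
      exact Submodule.smul_mem _ _ hx
    | hw w _ =>
      rcases w.eq_nil_or_concat with rfl | ⟨u, s, rfl⟩
      · refine Submodule.mem_sup_left (Submodule.subset_span ?_)
        simp
      · refine Submodule.mem_sup_right ⟨tw b η u [s], tmul_mem_complexTerm _ ⟨?_, ?_⟩, ?_⟩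
        · rw [range_ι_pow b]
          exact wd_mem_spanW b rfl
        · simp only [SetLike.mem_coe, Submodule.mem_iInf]
          intro i j hij
          omega
        · rw [differential_tw_cons, tw, wd_nil]
          simp
  · rintro z ⟨hz, hd⟩
    obtain ⟨g, hg, e⟩ := h.mem_map_differential (h.hasDualWords n) (Q := Set.univ)
      (fun _ _ _ _ => trivial) hz hd (Sp_mono b η (Set.subset_univ _) (h.complexTerm_le _ hz))
    exact ⟨g, hg.1, e⟩
  · rintro _ ⟨z, hz, rfl⟩
    exact ⟨differential_mem_complexTerm b hz, differential_differential_eq_zero b hz⟩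

/-- A quadratic algebra with a Poincaré-Birkhoff-Witt basis is Koszul. -/
theorem IsPBW.isQuadraticKoszul [WellFoundedLT S] (h : IsPBW b η good) : IsQuadraticKoszul η :=
  ⟨h.isQuadratic, h.koszulComplexAcyclic⟩

end

end Koszul

namespace TKK

open Module

/-! ### The Lie algebra sl₂ and the weights of its modules -/

section Basis

variable (k : Type u) [Field k]

/-- The coordinates of a traceless matrix with respect to the standard basis `e`, `h`, `f`. -/
noncomputable def sl2Coord : sl2 k ≃ₗ[k] (Fin 3 → k) where
  toFun x := ![x.1 0 1, x.1 0 0, x.1 1 0]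
  map_add' x y := by ext i; fin_cases i <;> simp
  map_smul' c x := by ext i; fin_cases i <;> simp
  invFun v := ⟨!![v 1, v 0; v 2, -v 1], by
    change Matrix.trace !![v 1, v 0; v 2, -v 1] = 0
    simp [Matrix.trace_fin_two]⟩
  left_inv x := by
    have : Matrix.trace x.1 = 0 := x.2
    rw [Matrix.trace_fin_two] at this
    apply Subtype.ext
    ext i j
    fin_cases i <;> fin_cases j <;> simp
    linear_combination -this
  right_inv v := by ext i; fin_cases i <;> simp

/-- The standard basis `e`, `h`, `f` of `sl₂`. -/
noncomputable def sl2Basis : Basis (Fin 3) k (sl2 k) := Basis.ofEquivFun (sl2Coord k)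

theorem sl2Basis_apply (i : Fin 3) :
    sl2Basis k i = (sl2Coord k).symm (Pi.single i 1) := by
  rw [sl2Basis, Basis.coe_ofEquivFun]

/-- The element `e` of `sl₂`. -/
noncomputable abbrev sE : sl2 k := sl2Basis k 0

/-- The element `h` of `sl₂`. -/
noncomputable abbrev sH : sl2 k := sl2Basis k 1

/-- The element `f` of `sl₂`. -/
noncomputable abbrev sF : sl2 k := sl2Basis k 2

theorem coe_sE : (sE k).1 = !![0, 1; 0, 0] := by
  rw [sE, sl2Basis_apply]
  change !![_, _; _, _] = _
  simp

theorem coe_sH : (sH k).1 = !![1, 0; 0, -1] := by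
  rw [sH, sl2Basis_apply]
  change !![_, _; _, _] = _
  simp

theorem coe_sF : (sF k).1 = !![0, 0; 1, 0] := by
  rw [sF, sl2Basis_apply]
  change !![_, _; _, _] = _
  simp

theorem coe_smul' (c : k) (x : sl2 k) : (c • x).1 = c • x.1 := rfl

theorem lie_HE : ⁅sH k, sE k⁆ = (2 : k) • sE k := by
  apply Subtype.ext
  rw [LieAlgebra.SpecialLinear.sl_bracket, coe_smul', coe_sE, coe_sH]
  ext i j; fin_cases i <;> fin_cases j <;> simp; norm_num

theorem lie_HF : ⁅sH k, sF k⁆ = (-2 : k) • sF k := by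
  apply Subtype.ext
  rw [LieAlgebra.SpecialLinear.sl_bracket, coe_smul', coe_sF, coe_sH]
  ext i j; fin_cases i <;> fin_cases j <;> simp; norm_num

theorem lie_EF : ⁅sE k, sF k⁆ = sH k := by
  apply Subtype.ext
  rw [LieAlgebra.SpecialLinear.sl_bracket, coe_sE, coe_sF, coe_sH]
  ext i j; fin_cases i <;> fin_cases j <;> simp

theorem lie_EH : ⁅sE k, sH k⁆ = (-2 : k) • sE k := by rw [← lie_skew, lie_HE, neg_smul]

theorem lie_FH : ⁅sF k, sH k⁆ = (2 : k) • sF k := by rw [← lie_skew, lie_HF, neg_smul, neg_neg]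

theorem lie_FE : ⁅sF k, sE k⁆ = -sH k := by rw [← lie_skew, lie_EF]

end Basis

section Modules

variable {k : Type u} [Field k]
variable {M : Type w} [AddCommGroup M] [Module k M] [LieRingModule (sl2 k) M]
  [LieModule k (sl2 k) M]
variable {M' : Type*} [AddCommGroup M'] [Module k M'] [LieRingModule (sl2 k) M']
  [LieModule k (sl2 k) M']

theorem sl2_induction {P : sl2 k → Prop} (he : P (sE k)) (hh : P (sH k)) (hf : P (sF k))
    (hadd : ∀ x y, P x → P y → P (x + y)) (hs : ∀ (c : k) x, P x → P (c • x)) (x : sl2 k) :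
    P x := by
  rw [← (sl2Basis k).sum_repr x, Fin.sum_univ_three]
  exact hadd _ _ (hadd _ _ (hs _ _ he) (hs _ _ hh)) (hs _ _ hf)

theorem map_lie_of_basis (φ : M →ₗ[k] M') (he : ∀ m, φ ⁅sE k, m⁆ = ⁅sE k, φ m⁆)
    (hh : ∀ m, φ ⁅sH k, m⁆ = ⁅sH k, φ m⁆) (hf : ∀ m, φ ⁅sF k, m⁆ = ⁅sF k, φ m⁆)
    (x : sl2 k) (m : M) : φ ⁅x, m⁆ = ⁅x, φ m⁆ := by
  induction x using sl2_induction with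
  | he => exact he m
  | hh => exact hh m
  | hf => exact hf m
  | hadd x y hx hy => rw [add_lie, add_lie, map_add, hx, hy]
  | hs c x hx => rw [smul_lie, smul_lie, map_smul, hx]

variable (k M) in
/-- The weights of `h` are among `0`, `2` and `-2`. -/
def SmallWeights : Prop := ∀ m : M, ⁅sH k, ⁅sH k, ⁅sH k, m⁆⁆⁆ = (4 : k) • ⁅sH k, m⁆

theorem smallWeights_sl2 : SmallWeights k (sl2 k) := by
  intro m
  induction m using sl2_induction with
  | he => simp only [lie_HE, lie_smul, smul_smul]; norm_num
  | hh => simp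
  | hf => simp only [lie_HF, lie_smul, smul_smul]; norm_num
  | hadd x y hx hy => simp only [lie_add, hx, hy, smul_add]
  | hs c x hx => simp only [lie_smul, hx]; rw [smul_comm]

theorem IsTKK.smallWeights (h : IsTKK k M) : SmallWeights k M := by
  obtain ⟨S, -, hS, hN⟩ := h
  let P : Submodule k M := LinearMap.ker
    ((LieModule.toEnd k (sl2 k) M (sH k)) ^ 3 - (4 : k) • LieModule.toEnd k (sl2 k) M (sH k))
  have hP : ∀ m, m ∈ P ↔ ⁅sH k, ⁅sH k, ⁅sH k, m⁆⁆⁆ = (4 : k) • ⁅sH k, m⁆ := by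
    intro m
    simp [P, sub_eq_zero, pow_succ]
  have hle : ∀ N ∈ S, (N : Submodule k M) ≤ P := by
    intro N hNS m hm
    rw [hP]
    rcases hN N hNS with hN | ⟨⟨ε⟩⟩
    · have := hN.1
      have h0 : ⁅sH k, m⁆ = 0 := congrArg Subtype.val
        (LieModule.IsTrivial.trivial (L := sl2 k) (sH k) (⟨m, hm⟩ : N))
      simp [h0]
    · have := smallWeights_sl2 (ε ⟨m, hm⟩)
      have h2 : ε ⁅sH k, ⁅sH k, ⁅sH k, ⟨m, hm⟩⁆⁆⁆ = ε ((4 : k) • ⁅sH k, ⟨m, hm⟩⁆) := by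
        rw [← LieModuleEquiv.coe_toLieModuleHom] at this ⊢
        rw [map_smul]
        simpa only [LieModuleHom.map_lie] using this
      exact congrArg Subtype.val (ε.injective h2)
  intro m
  rw [← hP]
  have htop : (sSup S : LieSubmodule k (sl2 k) M).toSubmodule ≤ P := by
    rw [LieSubmodule.sSup_toSubmodule, sSup_le_iff]
    rintro _ ⟨N, hN, rfl⟩
    exact hle N hN
  rw [hS] at htop
  exact htop trivial

/-- The roots of t³ - 4t are 0, 2 and -2. All the highest and lowest weight arguments below use this
vanishing, so no local finiteness has to be assumed. -/
theorem SmallWeights.eq_zero (h : SmallWeights k M) {c : k} {m : M} (hm : ⁅sH k, m⁆ = c • m)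
    (hc : c ^ 3 - 4 * c ≠ 0) : m = 0 := by
  have := h m
  simp only [hm, lie_smul, smul_smul] at this
  rw [← sub_eq_zero, ← sub_smul] at this
  refine (smul_eq_zero.1 this).resolve_left ?_
  rw [show c * c * c - 4 * c = c ^ 3 - 4 * c by ring]
  exact hc

theorem weight_E {c : k} {m : M} (hm : ⁅sH k, m⁆ = c • m) :
    ⁅sH k, ⁅sE k, m⁆⁆ = (c + 2) • ⁅sE k, m⁆ := by
  rw [leibniz_lie, hm, lie_HE, smul_lie, lie_smul, ← add_smul, add_comm]

theorem weight_F {c : k} {m : M} (hm : ⁅sH k, m⁆ = c • m) :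
    ⁅sH k, ⁅sF k, m⁆⁆ = (c - 2) • ⁅sF k, m⁆ := by
  rw [leibniz_lie, hm, lie_HF, smul_lie, lie_smul, ← add_smul, neg_add_eq_sub]

omit [Module k M] [LieModule k (sl2 k) M] in
theorem lie_E_F (m : M) : ⁅sE k, ⁅sF k, m⁆⁆ = ⁅sH k, m⁆ + ⁅sF k, ⁅sE k, m⁆⁆ := by
  rw [leibniz_lie, lie_EF]

variable [CharZero k]

/-- The map from `L(2)` given by a vector of weight `2`. -/
noncomputable def fromSl2 (h : SmallWeights k M) {m : M} (hm : ⁅sH k, m⁆ = (2 : k) • m) :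
    sl2 k →ₗ⁅k, sl2 k⁆ M :=
  have he : ⁅sE k, m⁆ = 0 := h.eq_zero (weight_E hm) (by norm_num)
  have hf := weight_F hm
  have hff := weight_F hf
  have hfff : ⁅sF k, ⁅sF k, ⁅sF k, m⁆⁆⁆ = 0 := h.eq_zero (weight_F hff) (by norm_num)
  have hef : ⁅sE k, ⁅sF k, m⁆⁆ = (2 : k) • m := by rw [lie_E_F, he, hm, lie_zero, add_zero]
  have heff : ⁅sE k, ⁅sF k, ⁅sF k, m⁆⁆⁆ = (2 : k) • ⁅sF k, m⁆ := by
    rw [lie_E_F, hf, hef, lie_smul]; simp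
  -- The images are forced by e ↦ `m`, since [f, e] = -h and [f, h] = 2f.
  { (sl2Basis k).constr k ![m, -⁅sF k, m⁆, (-(1 / 2) : k) • ⁅sF k, ⁅sF k, m⁆⁆] with
    map_lie' := by
      intro x n
      refine map_lie_of_basis ((sl2Basis k).constr k
        ![m, -⁅sF k, m⁆, (-(1 / 2) : k) • ⁅sF k, ⁅sF k, m⁆⁆]) ?_ ?_ ?_ x n
      all_goals
        intro n
        induction n using sl2_induction with
        | he =>
          simp only [lie_self, lie_HE, lie_FE, map_neg, map_smul, Basis.constr_basis]
          simp [he, hm]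
        | hh =>
          simp only [lie_self, lie_EH, lie_FH, map_smul, Basis.constr_basis]
          simp [hef, hf, smul_smul]
        | hf =>
          simp only [lie_self, lie_EF, lie_HF, map_smul, Basis.constr_basis]
          simp [heff, hfff, hff, smul_smul]
        | hadd x y hx hy => simp only [lie_add, map_add, hx, hy]
        | hs c x hx => simp only [lie_smul, map_smul, hx] }

theorem fromSl2_E (h : SmallWeights k M) {m : M} (hm : ⁅sH k, m⁆ = (2 : k) • m) :
    fromSl2 h hm (sE k) = m := by
  change (sl2Basis k).constr k _ (sl2Basis k 0) = m
  rw [Basis.constr_basis]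
  rfl

end Modules

end TKK

namespace TKK

open Module

/-! ### Modules with h³ = 4h are objects of TKK -/

section Modules

variable {k : Type u} [Field k] [CharZero k]
variable {M : Type w} [AddCommGroup M] [Module k M] [LieRingModule (sl2 k) M]
  [LieModule k (sl2 k) M]

theorem eq_top_of_mem_E {N : LieSubmodule k (sl2 k) (sl2 k)} (h : sE k ∈ N) : N = ⊤ := by
  have hh : sH k ∈ N := by
    have := N.lie_mem (x := sF k) h
    rw [lie_FE] at this
    simpa using this
  have hf : sF k ∈ N := by
    have := N.lie_mem (x := sF k) hh
    rw [lie_FH] at this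
    exact (Submodule.smul_mem_iff (N : Submodule k (sl2 k)) two_ne_zero).1 this
  rw [eq_top_iff]
  intro x _
  induction x using sl2_induction with
  | he => exact h
  | hh => exact hh
  | hf => exact hf
  | hadd x y hx hy => exact add_mem (hx trivial) (hy trivial)
  | hs c x hx => exact N.smul_mem c (hx trivial)

/-- The adjoint module of `sl₂` is irreducible. -/
theorem eq_top_of_mem {N : LieSubmodule k (sl2 k) (sl2 k)} {x : sl2 k} (hx : x ∈ N)
    (h0 : x ≠ 0) : N = ⊤ := by
  have hdec := (sl2Basis k).sum_repr x
  rw [Fin.sum_univ_three] at hdec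
  set α := (sl2Basis k).repr x 0
  set β := (sl2Basis k).repr x 1
  set γ := (sl2Basis k).repr x 2
  have h1 : ⁅sE k, x⁆ = (-2 * β) • sE k + γ • sH k := by
    rw [← hdec]
    simp only [lie_add, lie_smul, lie_self, lie_EH, lie_EF, smul_zero, zero_add, smul_smul]
    rw [mul_comm]
  have h2 : ⁅sE k, ⁅sE k, x⁆⁆ = (-2 * γ) • sE k := by
    rw [h1]
    simp only [lie_add, lie_smul, lie_self, lie_EH, smul_zero, zero_add, smul_smul]
    rw [mul_comm]
  have hm1 := N.lie_mem (x := sE k) hx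
  have hm2 := N.lie_mem (x := sE k) hm1
  by_cases hγ : γ = 0
  · by_cases hβ : β = 0
    · have hα : α ≠ 0 := by
        rintro hα
        apply h0
        rw [← hdec, hα, hβ, hγ]
        simp
      rw [← hdec, hβ, hγ, zero_smul, zero_smul, add_zero, add_zero] at hx
      exact eq_top_of_mem_E ((Submodule.smul_mem_iff (N : Submodule k (sl2 k)) hα).1 hx)
    · rw [h1, hγ, zero_smul, add_zero] at hm1
      exact eq_top_of_mem_E ((Submodule.smul_mem_iff (N : Submodule k (sl2 k))
        (mul_ne_zero (by norm_num) hβ)).1 hm1)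
  · rw [h2] at hm2
    exact eq_top_of_mem_E ((Submodule.smul_mem_iff (N : Submodule k (sl2 k))
      (mul_ne_zero (by norm_num) hγ)).1 hm2)

omit [LieModule k (sl2 k) M] in
theorem isAtom_of_isL2 {N : LieSubmodule k (sl2 k) M} (h : IsL2 k N) : IsAtom N := by
  obtain ⟨ε⟩ := h
  let φ : sl2 k →ₗ⁅k, sl2 k⁆ M := N.incl.comp ε.symm.toLieModuleHom
  have hφ : ∀ m (hm : m ∈ N), φ (ε ⟨m, hm⟩) = m := fun m hm => by simp [φ]
  have hφN : ∀ x, φ x ∈ N := fun x => (ε.symm x).2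
  refine ⟨?_, fun N' hlt => ?_⟩
  · rintro rfl
    have h1 : ε.symm (sE k) = 0 := Subsingleton.elim _ _
    have : sE k = 0 := by
      rw [← ε.apply_symm_apply (sE k), h1, ← LieModuleEquiv.coe_toLieModuleHom, map_zero]
    exact (sl2Basis k).ne_zero 0 this
  · by_contra hne
    obtain ⟨m, hm, hm0⟩ : ∃ m ∈ N', m ≠ 0 := by
      by_contra! hcon
      exact hne ((LieSubmodule.eq_bot_iff N').2 hcon)
    have htop : N'.comap φ = ⊤ := by
      refine eq_top_of_mem (x := ε ⟨m, hlt.le hm⟩) ?_ ?_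
      · rw [LieSubmodule.mem_comap, hφ]
        exact hm
      · intro h0
        have := hφ m (hlt.le hm)
        rw [h0, map_zero] at this
        exact hm0 this.symm
    refine hlt.not_ge fun y hy => ?_
    have : ε ⟨y, hy⟩ ∈ N'.comap φ := by rw [htop]; trivial
    rw [LieSubmodule.mem_comap, hφ] at this
    exact this

omit [CharZero k] [LieModule k (sl2 k) M] in
theorem isAtom_of_isL0 {N : LieSubmodule k (sl2 k) M} (h : IsL0 k N) : IsAtom N := by
  have h1 := h.2
  refine ⟨?_, fun N' hlt => ?_⟩
  · rintro rfl
    have : Subsingleton (⊥ : LieSubmodule k (sl2 k) M) := inferInstance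
    rw [Module.finrank_zero_of_subsingleton] at h1
    exact zero_ne_one h1
  · have hfr : Module.finrank k N.toSubmodule = 1 := h1
    have : FiniteDimensional k N.toSubmodule := Module.finite_of_finrank_pos (by omega)
    have hlt' := Submodule.finrank_lt_finrank_of_lt
      (show N'.toSubmodule < N.toSubmodule from hlt)
    have : FiniteDimensional k N'.toSubmodule :=
      Submodule.finiteDimensional_of_le (show N'.toSubmodule ≤ N.toSubmodule from hlt.le)
    have h0 := Submodule.finrank_eq_zero.1 (show Module.finrank k N'.toSubmodule = 0 by omega)
    simpa using h0

omit [LieModule k (sl2 k) M] in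
theorem isL2_range {φ : sl2 k →ₗ⁅k, sl2 k⁆ M} (h : φ (sE k) ≠ 0) : IsL2 k φ.range := by
  have hinj : Function.Injective φ := by
    rw [injective_iff_map_eq_zero]
    intro x hx
    by_contra h0
    have := eq_top_of_mem (N := φ.ker) (x := x) (by simpa using hx) h0
    have h' : sE k ∈ φ.ker := by rw [this]; trivial
    exact h (by simpa using h')
  let ε := LinearEquiv.ofInjective (φ : sl2 k →ₗ[k] M) hinj
  let ψ : sl2 k ≃ₗ⁅k, sl2 k⁆ φ.range :=
    { toFun := fun x => ⟨φ x, x, rfl⟩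
      map_add' := fun x y => Subtype.ext (map_add φ x y)
      map_smul' := fun c x => Subtype.ext (map_smul φ c x)
      map_lie' := fun {x y} => Subtype.ext (LieModuleHom.map_lie φ x y)
      invFun := fun y => ε.symm y
      left_inv := fun x => ε.symm_apply_apply x
      right_inv := fun y => ε.apply_symm_apply y }
  exact ⟨ψ.symm⟩

omit [CharZero k] in
theorem isL0_span {m : M} (h0 : m ≠ 0) (hm : ∀ x : sl2 k, ⁅x, m⁆ = 0) :
    ∃ N : LieSubmodule k (sl2 k) M, IsL0 k N ∧ N.toSubmodule = Submodule.span k {m} := by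
  let N : LieSubmodule k (sl2 k) M :=
    { Submodule.span k {m} with
      lie_mem := by
        rintro x y hy
        obtain ⟨c, rfl⟩ := Submodule.mem_span_singleton.1 hy
        rw [lie_smul, hm, smul_zero]
        exact zero_mem (Submodule.span k {m}) }
  refine ⟨N, ⟨⟨?_⟩, finrank_span_singleton h0⟩, rfl⟩
  rintro x ⟨y, hy⟩
  apply Subtype.ext
  obtain ⟨c, rfl⟩ := Submodule.mem_span_singleton.1 hy
  change ⁅x, c • m⁆ = 0
  rw [lie_smul, hm, smul_zero]

/-- Stated for every submodule `N`, so that it also applies to an atom. A vector of weight 2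
generates a copy of L(2); a vector of weight 0 is the sum of an invariant and a vector of such a
copy; a vector of weight -2 is a multiple of f applied to one of weight 0. -/
theorem SmallWeights.le_sSup (h : SmallWeights k M) (N : LieSubmodule k (sl2 k) M) :
    N ≤ sSup {L | L ≤ N ∧ (IsL0 k L ∨ IsL2 k L)} := by
  set P := sSup {L : LieSubmodule k (sl2 k) M | L ≤ N ∧ (IsL0 k L ∨ IsL2 k L)} with hP
  have hPle : ∀ L : LieSubmodule k (sl2 k) M, L ≤ N → IsL0 k L ∨ IsL2 k L → L ≤ P :=
    fun L h1 h2 => _root_.le_sSup ⟨h1, h2⟩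
  have h2 : ∀ m ∈ N, ⁅sH k, m⁆ = (2 : k) • m → m ∈ P := by
    intro m hmN hm
    by_cases h0 : m = 0
    · exact h0 ▸ zero_mem _
    have hE : fromSl2 h hm (sE k) = m := fromSl2_E h hm
    have hle : (fromSl2 h hm).range ≤ N := by
      rintro _ ⟨x, rfl⟩
      have : (N.comap (fromSl2 h hm)) = ⊤ := eq_top_of_mem_E (by
        rw [LieSubmodule.mem_comap, hE]; exact hmN)
      have hx : x ∈ N.comap (fromSl2 h hm) := by rw [this]; trivial
      exact hx
    have hL2 : IsL2 k (fromSl2 h hm).range := isL2_range (by rw [hE]; exact h0)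
    exact hPle _ hle (Or.inr hL2) ⟨sE k, hE⟩
  have h0 : ∀ m ∈ N, ⁅sH k, m⁆ = (0 : k) • m → m ∈ P := by
    intro m hmN hm
    have he := weight_E hm
    rw [zero_add] at he
    have heN := N.lie_mem (x := sE k) hmN
    have hee : ⁅sE k, ⁅sE k, m⁆⁆ = 0 := h.eq_zero (weight_E he) (by norm_num)
    -- Since em has weight 2 and eem = 0, e(fem) = h(em) = 2em; the factor 1/2 makes en = 0.
    set n := m - (1 / 2 : k) • ⁅sF k, ⁅sE k, m⁆⁆ with hn
    have hHn : ⁅sH k, n⁆ = (0 : k) • n := by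
      rw [hn, lie_sub, lie_smul, weight_F he, hm]
      simp
    have hEn : ⁅sE k, n⁆ = 0 := by
      rw [hn, lie_sub, lie_smul, lie_E_F, hee, he, lie_zero, add_zero, smul_smul]
      norm_num
    -- The vector ffn has weight -4 and vanishes, while effn = -2fn.
    have hFn : ⁅sF k, n⁆ = 0 := by
      have h1 := weight_F hHn
      have h2 : ⁅sF k, ⁅sF k, n⁆⁆ = 0 := h.eq_zero (weight_F h1) (by norm_num)
      have h3 := lie_E_F (k := k) ⁅sF k, n⁆
      rw [h2, lie_zero, h1, lie_E_F, hEn, hHn] at h3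
      simpa using h3
    have hnP : n ∈ P := by
      by_cases hn0 : n = 0
      · exact hn0 ▸ zero_mem _
      obtain ⟨L, hL, hLs⟩ := isL0_span (k := k) hn0 (fun x => by
        induction x using sl2_induction with
        | he => exact hEn
        | hh => rw [hHn, zero_smul]
        | hf => exact hFn
        | hadd x y hx hy => rw [add_lie, hx, hy, add_zero]
        | hs c x hx => rw [smul_lie, hx, smul_zero])
      have hnN : n ∈ N := sub_mem hmN (N.smul_mem _ (N.lie_mem heN))
      refine hPle L ?_ (Or.inl hL) ?_
      · rw [← LieSubmodule.toSubmodule_le_toSubmodule, hLs, Submodule.span_singleton_le_iff_mem]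
        exact hnN
      · rw [← LieSubmodule.mem_toSubmodule, hLs]
        exact Submodule.mem_span_singleton_self n
    have : m = n + (1 / 2 : k) • ⁅sF k, ⁅sE k, m⁆⁆ := by rw [hn, sub_add_cancel]
    rw [this]
    exact add_mem hnP (P.smul_mem _ (P.lie_mem (h2 _ heN he)))
  have hm2 : ∀ m ∈ N, ⁅sH k, m⁆ = (-2 : k) • m → m ∈ P := by
    intro m hmN hm
    have hF : ⁅sF k, m⁆ = 0 := h.eq_zero (weight_F hm) (by norm_num)
    have hE := weight_E hm
    have h1 := lie_E_F (k := k) m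
    rw [hF, lie_zero, hm] at h1
    have h3 : (2 : k) • m = ⁅sF k, ⁅sE k, m⁆⁆ := by
      rw [neg_smul, eq_comm, neg_add_eq_zero] at h1
      exact h1
    have h4 : (2 : k) • m ∈ P := by
      rw [h3]
      refine P.lie_mem (h0 _ (N.lie_mem hmN) ?_)
      rw [hE]
      norm_num
    exact (Submodule.smul_mem_iff (P : Submodule k M) two_ne_zero).1 h4
  intro m hm
  have hH := N.lie_mem (x := sH k) hm
  have hHH := N.lie_mem (x := sH k) hH
  have hHHH := h m
  set x := ⁅sH k, m⁆
  set y := ⁅sH k, x⁆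
  -- Interpolation at the roots of t³ - 4t: the projectors to the weights 0, 2, -2 are 1 - h²/4, (h²
  -- + 2h)/8 and (h² - 2h)/8.
  have e : m = (m - (1 / 4 : k) • y) + ((1 / 8 : k) • (y + (2 : k) • x) +
      (1 / 8 : k) • (y - (2 : k) • x)) := by
    module
  rw [e]
  refine add_mem (h0 _ (sub_mem hm (N.smul_mem _ hHH)) ?_) (add_mem
    (h2 _ (N.smul_mem _ (add_mem hHH (N.smul_mem _ hH))) ?_)
    (hm2 _ (N.smul_mem _ (sub_mem hHH (N.smul_mem _ hH))) ?_))
  · rw [lie_sub, lie_smul, hHHH]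
    change x - _ = _
    module
  · rw [lie_smul, lie_add, lie_smul, hHHH]
    change (1 / 8 : k) • ((4 : k) • x + (2 : k) • y) = _
    module
  · rw [lie_smul, lie_sub, lie_smul, hHHH]
    change (1 / 8 : k) • ((4 : k) • x - (2 : k) • y) = _
    module

/-- A module with the weights `0`, `2` and `-2` only is a sum of copies of `L(0)` and `L(2)`. -/
theorem SmallWeights.isTKK (h : SmallWeights k M) : IsTKK k M := by
  have htop : sSup {N : LieSubmodule k (sl2 k) M | IsAtom N} = ⊤ := by
    rw [eq_top_iff]
    refine (h.le_sSup ⊤).trans (sSup_le_sSup ?_)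
    rintro L ⟨-, hL | hL⟩
    exacts [isAtom_of_isL0 hL, isAtom_of_isL2 hL]
  obtain ⟨S, hS, hS', hat⟩ := exists_sSupIndep_of_sSup_atoms_eq_top htop
  refine ⟨S, hS, hS', fun N hN => ?_⟩
  have hN' := hat hN
  -- An atom is the sum of the copies of L(0) and L(2) inside it, so it contains one, and then
  -- equals it.
  by_contra hcon
  have hempty : {L : LieSubmodule k (sl2 k) M | L ≤ N ∧ (IsL0 k L ∨ IsL2 k L)} = ∅ := by
    rw [Set.eq_empty_iff_forall_notMem]
    rintro L ⟨hle, hL⟩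
    have hLat : IsAtom L := hL.elim isAtom_of_isL0 isAtom_of_isL2
    rcases hN'.le_iff.1 hle with rfl | rfl
    · exact hLat.1 rfl
    · exact hcon hL
  have := h.le_sSup N
  rw [hempty, sSup_empty, le_bot_iff] at this
  exact hN'.1 this

end Modules

end TKK

namespace TKK

open Module

/-- The generators: `z i` spans a copy of `L(0)`, and `x 0 u`, `x 1 u`, `x 2 u` correspond to the
basis `e`, `h`, `f` of a copy of `L(2)`. -/
inductive Letter (I₀ I₂ : Type v) : Type v
  | z (i : I₀) : Letter I₀ I₂
  | x (j : Fin 3) (u : I₂) : Letter I₀ I₂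

/-! ### Bases adapted to a decomposition -/

section Basis

variable {k : Type u} [Field k]
variable {U : Type v} [AddCommGroup U] [Module k U] [LieRingModule (sl2 k) U]
  [LieModule k (sl2 k) U]

/-- A basis adapted to a decomposition into copies of `L(0)` and `L(2)`. -/
def IsAdapted {I₀ I₂ : Type v} (b : Basis (Letter I₀ I₂) k U) : Prop :=
  (∀ (x : sl2 k) i, ⁅x, b (.z i)⁆ = 0) ∧
    ∀ u, ∃ φ : sl2 k →ₗ⁅k, sl2 k⁆ U, ∀ j, φ (sl2Basis k j) = b (.x j u)

omit [LieModule k (sl2 k) U] in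
theorem IsTKK.exists_isAdapted (h : IsTKK k U) :
    ∃ (I₀ I₂ : Type v) (b : Basis (Letter I₀ I₂) k U), IsAdapted b := by
  classical
  obtain ⟨S, hind, htop, hS⟩ := h
  let I₀ : Type v := {N : LieSubmodule k (sl2 k) U // N ∈ S ∧ IsL0 k N}
  let I₂ : Type v := {N : LieSubmodule k (sl2 k) U // N ∈ S ∧ ¬ IsL0 k N}
  let r : I₀ ⊕ I₂ → S := Sum.elim (fun N => ⟨N.1, N.2.1⟩) (fun N => ⟨N.1, N.2.1⟩)
  have hr : Function.Injective r := by
    rintro (⟨N, hN⟩ | ⟨N, hN⟩) (⟨N', hN'⟩ | ⟨N', hN'⟩) e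
    all_goals
      have e' : N = N' := congrArg Subtype.val e
      subst e'
    · rfl
    · exact absurd hN.2 hN'.2
    · exact absurd hN'.2 hN.2
    · rfl
  let W : I₀ ⊕ I₂ → Submodule k U := fun i => (r i).1.toSubmodule
  have hWind : iSupIndep W := by
    have h1 : iSupIndep (fun N : S => (N : LieSubmodule k (sl2 k) U)) := sSupIndep_iff S |>.1 hind
    exact (LieSubmodule.iSupIndep_toSubmodule.2 h1).comp hr
  have hWtop : iSup W = ⊤ := by
    rw [eq_top_iff, ← LieSubmodule.top_toSubmodule (R := k) (L := sl2 k) (M := U), ← htop,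
      LieSubmodule.sSup_toSubmodule, sSup_le_iff]
    rintro _ ⟨N, hN, rfl⟩
    by_cases hN0 : IsL0 k N
    · exact le_iSup W (Sum.inl ⟨N, hN, hN0⟩)
    · exact le_iSup W (Sum.inr ⟨N, hN, hN0⟩)
  have hint := DirectSum.isInternal_submodule_of_iSupIndep_of_iSup_eq_top hWind hWtop
  have hε : ∀ N : I₂, Nonempty (N.1 ≃ₗ⁅k, sl2 k⁆ sl2 k) := fun N =>
    (hS N.1 N.2.1).resolve_left N.2.2
  let ε := fun N => Classical.choice (hε N)
  let κ : I₀ ⊕ I₂ → Type := Sum.elim (fun _ => Unit) (fun _ => Fin 3)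
  let β : ∀ i, Basis (κ i) k (W i) := fun i => match i with
    | .inl N => Module.basisUnique Unit N.2.2.2
    | .inr N => (sl2Basis k).map (ε N).toLinearEquiv.symm
  let σ : (Σ i, κ i) ≃ Letter I₀ I₂ :=
    { toFun := fun a => match a with
        | ⟨.inl N, _⟩ => .z N
        | ⟨.inr N, j⟩ => .x j N
      invFun := fun l => match l with
        | .z N => ⟨.inl N, ()⟩
        | .x j N => ⟨.inr N, j⟩
      left_inv := by rintro ⟨N | N, j⟩ <;> rfl
      right_inv := by rintro (N | ⟨j, N⟩) <;> rfl }
  refine ⟨I₀, I₂, (hint.collectedBasis β).reindex σ, fun x N => ?_, fun N => ?_⟩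
  · rw [Basis.reindex_apply, hint.collectedBasis_coe]
    have ht : LieModule.IsTrivial (sl2 k) N.1 := N.2.2.1
    exact congrArg Subtype.val (ht.trivial x (β (.inl N) ()))
  · refine ⟨N.1.incl.comp (ε N).symm.toLieModuleHom, fun j => ?_⟩
    rw [Basis.reindex_apply, hint.collectedBasis_coe]
    rfl

end Basis

/-! ### The action on polynomials and the L(4) relations -/

section Action

variable (k : Type u) [Field k] (I₀ I₂ : Type v)

/-- The polynomial ring on the generators. -/
abbrev Poly : Type (max u v) := MvPolynomial (Letter I₀ I₂) k

variable {I₀ I₂}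

/-- The copy of `sl₂` in the polynomial ring with the label `u`. -/
noncomputable def copy (u : I₂) : sl2 k →ₗ[k] Poly k I₀ I₂ :=
  (sl2Basis k).constr k fun j => MvPolynomial.X (.x j u)

theorem copy_basis (u : I₂) (j : Fin 3) :
    copy (I₀ := I₀) k u (sl2Basis k j) = MvPolynomial.X (.x j u) := by
  rw [copy, Basis.constr_basis]

/-- The value of an element of `sl₂` on a generator. -/
noncomputable def actLetter (x : sl2 k) : Letter I₀ I₂ → Poly k I₀ I₂
  | .z _ => 0
  | .x j u => copy k u ⁅x, sl2Basis k j⁆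

/-- The action of `sl₂` on the polynomial ring by derivations. -/
noncomputable def act (x : sl2 k) : Derivation k (Poly k I₀ I₂) (Poly k I₀ I₂) :=
  MvPolynomial.mkDerivation k (actLetter k x)

theorem act_z (x : sl2 k) (i : I₀) : act (I₂ := I₂) k x (MvPolynomial.X (.z i)) = 0 := by
  rw [act, MvPolynomial.mkDerivation_X, actLetter]

theorem act_copy (x y : sl2 k) (u : I₂) :
    act (I₀ := I₀) k x (copy k u y) = copy k u ⁅x, y⁆ := by
  have : ((act (I₀ := I₀) k x).toLinearMap).comp (copy k u) =
      (copy k u).comp (LieModule.toEnd k (sl2 k) (sl2 k) x) := by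
    refine (sl2Basis k).ext fun j => ?_
    simp only [LinearMap.comp_apply, copy_basis]
    rw [Derivation.coeFn_coe, act, MvPolynomial.mkDerivation_X]
    rfl
  exact LinearMap.congr_fun this y

theorem act_add (x y : sl2 k) : act (I₀ := I₀) (I₂ := I₂) k (x + y) = act k x + act k y := by
  refine MvPolynomial.derivation_ext fun l => ?_
  rw [Derivation.add_apply]
  cases l with
  | z i => simp [act_z]
  | x j u => simp only [← copy_basis, act_copy, add_lie, map_add]

theorem act_smul (c : k) (x : sl2 k) :
    act (I₀ := I₀) (I₂ := I₂) k (c • x) = c • act k x := by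
  refine MvPolynomial.derivation_ext fun l => ?_
  rw [Derivation.smul_apply]
  cases l with
  | z i => simp [act_z]
  | x j u => simp only [← copy_basis, act_copy, smul_lie, map_smul]

theorem act_lie (x y : sl2 k) (p : Poly k I₀ I₂) :
    act k ⁅x, y⁆ p = act k x (act k y p) - act k y (act k x p) := by
  have : act (I₀ := I₀) (I₂ := I₂) k ⁅x, y⁆ = ⁅act (I₀ := I₀) (I₂ := I₂) k x,
      act (I₀ := I₀) (I₂ := I₂) k y⁆ := by
    refine MvPolynomial.derivation_ext fun l => ?_
    rw [Derivation.commutator_apply]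
    cases l with
    | z i => simp [act_z]
    | x j u => simp only [← copy_basis, act_copy, ← map_sub, lie_lie]
  rw [this, Derivation.commutator_apply]

/-- The quadratic relations: a basis of the copy of `L(4)` in the product of two copies of
`L(2)`. -/
noncomputable def rel (n : Fin 5) (u v : I₂) : Poly k I₀ I₂ :=
  match n with
  | 0 => .X (.x 0 u) * .X (.x 0 v)
  | 1 => .X (.x 1 u) * .X (.x 0 v) + .X (.x 0 u) * .X (.x 1 v)
  | 2 => .X (.x 1 u) * .X (.x 1 v) - .X (.x 2 u) * .X (.x 0 v) - .X (.x 0 u) * .X (.x 2 v)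
  | 3 => .X (.x 2 u) * .X (.x 1 v) + .X (.x 1 u) * .X (.x 2 v)
  | 4 => .X (.x 2 u) * .X (.x 2 v)

variable (I₀ I₂) in
/-- The ideal of relations of the free commutative algebra. -/
noncomputable def relIdeal : Ideal (Poly k I₀ I₂) :=
  Ideal.span {p | ∃ n u v, rel k n u v = p}

theorem rel_mem (n : Fin 5) (u v : I₂) : rel k n u v ∈ relIdeal k I₀ I₂ :=
  Ideal.subset_span ⟨n, u, v, rfl⟩

/-- For fixed labels the five relations span a stable space: e lowers the index, f raises it
(`act_F_rel`), and h acts diagonally with weights 4, 2, 0, -2, -4 (`act_H_rel`). Hence the ideal is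
stable under all of sl₂. -/
theorem act_E_rel (n : Fin 5) (u v : I₂) :
    ∃ n' c, act (I₀ := I₀) k (sE k) (rel k n u v) = c * rel k n' u v := by
  have he : ∀ u, act (I₀ := I₀) (I₂ := I₂) k (sE k) (.X (.x 0 u)) = 0 := fun u => by
    rw [← copy_basis, act_copy, lie_self, map_zero]
  have hh : ∀ u, act (I₀ := I₀) (I₂ := I₂) k (sE k) (.X (.x 1 u)) = -2 * .X (.x 0 u) := fun u => by
    rw [← copy_basis, act_copy, lie_EH, map_smul, copy_basis, neg_smul, two_smul]; ring
  have hf : ∀ u, act (I₀ := I₀) (I₂ := I₂) k (sE k) (.X (.x 2 u)) = .X (.x 1 u) := fun u => by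
    rw [← copy_basis, act_copy, lie_EF, copy_basis]
  fin_cases n
  · refine ⟨0, 0, ?_⟩
    simp [rel, he]
  · refine ⟨0, -4, ?_⟩
    simp [rel, he, hh]; ring
  · refine ⟨1, -3, ?_⟩
    simp [rel, he, hh, hf]; ring
  · refine ⟨2, 2, ?_⟩
    simp [rel, hh, hf]; ring
  · refine ⟨3, 1, ?_⟩
    simp [rel, hf]; ring

theorem act_F_rel (n : Fin 5) (u v : I₂) :
    ∃ n' c, act (I₀ := I₀) k (sF k) (rel k n u v) = c * rel k n' u v := by
  have he : ∀ u, act (I₀ := I₀) (I₂ := I₂) k (sF k) (.X (.x 0 u)) = -.X (.x 1 u) := fun u => by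
    rw [← copy_basis, act_copy, lie_FE, map_neg, copy_basis]
  have hh : ∀ u, act (I₀ := I₀) (I₂ := I₂) k (sF k) (.X (.x 1 u)) = 2 * .X (.x 2 u) := fun u => by
    rw [← copy_basis, act_copy, lie_FH, map_smul, copy_basis, two_smul]; ring
  have hf : ∀ u, act (I₀ := I₀) (I₂ := I₂) k (sF k) (.X (.x 2 u)) = 0 := fun u => by
    rw [← copy_basis, act_copy, lie_self, map_zero]
  fin_cases n
  · refine ⟨1, -1, ?_⟩
    simp [rel, he]; ring
  · refine ⟨2, -2, ?_⟩
    simp [rel, he, hh]; ring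
  · refine ⟨3, 3, ?_⟩
    simp [rel, he, hh, hf]; ring
  · refine ⟨4, 4, ?_⟩
    simp [rel, hh, hf]; ring
  · refine ⟨0, 0, ?_⟩
    simp [rel, hf]

theorem act_H_X (j : Fin 3) (u : I₂) : act (I₀ := I₀) (I₂ := I₂) k (sH k) (.X (.x j u)) =
    (![2, 0, -2] : Fin 3 → Poly k I₀ I₂) j * .X (.x j u) := by
  rw [← copy_basis, act_copy]
  fin_cases j
  · simp only [Fin.zero_eta, lie_HE, two_smul]; simp [two_mul]
  · simp
  · simp only [Fin.reduceFinMk, lie_HF, neg_smul, two_smul]; simp [two_mul]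

theorem act_H_rel (n : Fin 5) (u v : I₂) :
    ∃ c, act (I₀ := I₀) k (sH k) (rel k n u v) = c * rel k n u v := by
  refine ⟨(![4, 2, 0, -2, -4] : Fin 5 → Poly k I₀ I₂) n, ?_⟩
  fin_cases n <;> simp [rel, act_H_X] <;> ring

theorem act_mem_relIdeal (x : sl2 k) {p : Poly k I₀ I₂} (hp : p ∈ relIdeal k I₀ I₂) :
    act k x p ∈ relIdeal k I₀ I₂ := by
  induction hp using Submodule.span_induction with
  | zero => simp
  | add p q _ _ hp hq => rw [map_add]; exact add_mem hp hq
  | smul a p hp' hp =>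
    rw [smul_eq_mul, Derivation.leibniz]
    exact add_mem (Ideal.mul_mem_left _ _ hp) (Ideal.mul_mem_right _ _ hp')
  | mem p hp =>
    obtain ⟨n, u, v, rfl⟩ := hp
    induction x using sl2_induction with
    | he =>
      obtain ⟨n', c, e⟩ := act_E_rel (I₀ := I₀) k n u v
      rw [e]
      exact Ideal.mul_mem_left _ _ (rel_mem k n' u v)
    | hh =>
      obtain ⟨c, e⟩ := act_H_rel (I₀ := I₀) k n u v
      rw [e]
      exact Ideal.mul_mem_left _ _ (rel_mem k n u v)
    | hf =>
      obtain ⟨n', c, e⟩ := act_F_rel (I₀ := I₀) k n u v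
      rw [e]
      exact Ideal.mul_mem_left _ _ (rel_mem k n' u v)
    | hadd x y hx hy => rw [act_add, Derivation.add_apply]; exact add_mem hx hy
    | hs c x hx =>
      rw [act_smul, Derivation.smul_apply, Algebra.smul_def]
      exact Ideal.mul_mem_left _ _ hx

end Action

end TKK

namespace TKK

open Module

/-! ### The quotient algebra lies in TKK -/

section Quotient

variable (k : Type u) [Field k] (I₀ I₂ : Type v)

/-- The underlying ring of the free commutative algebra. -/
abbrev FreeRing : Type (max u v) := Poly k I₀ I₂ ⧸ relIdeal k I₀ I₂

variable {I₀ I₂}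

/-- The action of `sl₂` on the free commutative algebra. -/
noncomputable def actFree (x : sl2 k) (q : FreeRing k I₀ I₂) : FreeRing k I₀ I₂ :=
  Ideal.Quotient.mk _ (act k x (Function.surjInv Ideal.Quotient.mk_surjective q))

theorem actFree_mk (x : sl2 k) (p : Poly k I₀ I₂) :
    actFree k x (Ideal.Quotient.mk _ p) = Ideal.Quotient.mk _ (act k x p) := by
  rw [actFree, Ideal.Quotient.eq, ← map_sub]
  refine act_mem_relIdeal k x ?_
  rw [← Ideal.Quotient.eq]
  exact Function.surjInv_eq Ideal.Quotient.mk_surjective _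

noncomputable instance : LieRingModule (sl2 k) (FreeRing k I₀ I₂) where
  bracket := actFree k
  add_lie x y q := by
    obtain ⟨p, rfl⟩ := Ideal.Quotient.mk_surjective q
    change actFree k _ _ = actFree k _ _ + actFree k _ _
    simp only [actFree_mk, act_add, Derivation.add_apply, map_add]
  lie_add x q q' := by
    obtain ⟨p, rfl⟩ := Ideal.Quotient.mk_surjective q
    obtain ⟨p', rfl⟩ := Ideal.Quotient.mk_surjective q'
    change actFree k _ _ = actFree k _ _ + actFree k _ _
    rw [← map_add (Ideal.Quotient.mk _), actFree_mk, actFree_mk, actFree_mk, map_add, map_add]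
  leibniz_lie x y q := by
    obtain ⟨p, rfl⟩ := Ideal.Quotient.mk_surjective q
    change actFree k _ (actFree k _ _) = actFree k _ _ + actFree k _ (actFree k _ _)
    simp only [actFree_mk, act_lie, map_sub, sub_add_cancel]

theorem lie_mk (x : sl2 k) (p : Poly k I₀ I₂) :
    ⁅x, (Ideal.Quotient.mk _ p : FreeRing k I₀ I₂)⁆ = Ideal.Quotient.mk _ (act k x p) :=
  actFree_mk k x p

theorem mk_smul (c : k) (p : Poly k I₀ I₂) :
    c • (Ideal.Quotient.mk _ p : FreeRing k I₀ I₂) = Ideal.Quotient.mk _ (c • p) := rfl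

noncomputable instance : LieModule k (sl2 k) (FreeRing k I₀ I₂) where
  smul_lie c x q := by
    obtain ⟨p, rfl⟩ := Ideal.Quotient.mk_surjective q
    rw [lie_mk, lie_mk, act_smul, Derivation.smul_apply, mk_smul]
  lie_smul c x q := by
    obtain ⟨p, rfl⟩ := Ideal.Quotient.mk_surjective q
    rw [mk_smul, lie_mk, lie_mk, Derivation.map_smul, mk_smul]

theorem lie_mul_freeRing (x : sl2 k) (a b : FreeRing k I₀ I₂) :
    ⁅x, a * b⁆ = ⁅x, a⁆ * b + a * ⁅x, b⁆ := by
  obtain ⟨p, rfl⟩ := Ideal.Quotient.mk_surjective a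
  obtain ⟨q, rfl⟩ := Ideal.Quotient.mk_surjective b
  rw [← map_mul, lie_mk, lie_mk, lie_mk, Derivation.leibniz, ← map_mul, ← map_mul, ← map_add,
    smul_eq_mul, smul_eq_mul, mul_comm q, add_comm]

/-- The generators of the free commutative algebra. -/
noncomputable def gen (l : Letter I₀ I₂) : FreeRing k I₀ I₂ := Ideal.Quotient.mk _ (.X l)

theorem lie_gen_z (x : sl2 k) (i : I₀) : ⁅x, gen (I₂ := I₂) k (.z i)⁆ = 0 := by
  rw [gen, lie_mk, act_z, map_zero]

/-- The copies of `sl₂` in the free commutative algebra. -/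
noncomputable def copyFree (u : I₂) : sl2 k →ₗ[k] FreeRing k I₀ I₂ :=
  (Ideal.Quotient.mkₐ k _).toLinearMap.comp (copy k u)

theorem copyFree_basis (u : I₂) (j : Fin 3) :
    copyFree (I₀ := I₀) k u (sl2Basis k j) = gen k (.x j u) := by
  rw [copyFree, LinearMap.comp_apply, copy_basis]
  rfl

theorem lie_copyFree (u : I₂) (x y : sl2 k) :
    ⁅x, copyFree (I₀ := I₀) k u y⁆ = copyFree k u ⁅x, y⁆ := by
  change ⁅x, Ideal.Quotient.mk _ (copy k u y)⁆ = _
  rw [lie_mk, act_copy]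
  rfl

theorem lie_H_gen (j : Fin 3) (u : I₂) : ⁅sH k, gen (I₀ := I₀) k (.x j u)⁆ =
    (![2, 0, -2] : Fin 3 → k) j • gen k (.x j u) := by
  rw [← copyFree_basis, lie_copyFree]
  fin_cases j
  · simp [lie_HE]
  · simp
  · simp only [Fin.reduceFinMk, lie_HF, map_smul]; simp

theorem gen_mul_eq_zero {j : Fin 3} (hj : j ≠ 1) (u v : I₂) :
    gen (I₀ := I₀) k (.x j u) * gen k (.x j v) = 0 := by
  rw [gen, gen, ← map_mul, Ideal.Quotient.eq_zero_iff_mem]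
  fin_cases j
  · exact rel_mem k 0 u v
  · exact absurd rfl hj
  · exact rel_mem k 4 u v

/-- The monomials, classified by the numbers of factors of type `e` and `f`. -/
def IsMono (a b : Fin 2) (q : FreeRing k I₀ I₂) : Prop :=
  ⁅sH k, q⁆ = ((![0, 2] : Fin 2 → k) a + (![0, -2] : Fin 2 → k) b) • q ∧
    (a = 1 → ∀ v, gen k (.x 0 v) * q = 0) ∧ (b = 1 → ∀ v, gen k (.x 2 v) * q = 0)

/-- A second factor of type e or f makes the product zero, and zero satisfies the conditions for any
`a` and `b`; therefore the two counts never exceed one. -/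
theorem exists_isMono_gen_mul {a b : Fin 2} {q : FreeRing k I₀ I₂} (h : IsMono k a b q)
    (l : Letter I₀ I₂) : ∃ a' b', IsMono k a' b' (gen k l * q) := by
  obtain ⟨h1, h2, h3⟩ := h
  have key : ∀ l' l'' : Letter I₀ I₂, gen k l' * q = 0 → gen k l' * (gen k l'' * q) = 0 := by
    intro l' l'' h
    rw [mul_left_comm, h, mul_zero]
  cases l with
  | z i =>
    refine ⟨a, b, ?_, fun ha v => key _ _ (h2 ha v), fun hb v => key _ _ (h3 hb v)⟩
    rw [lie_mul_freeRing, lie_gen_z, h1, zero_mul, zero_add, mul_smul_comm]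
  | x j u =>
    have hH : ⁅sH k, gen k (.x j u) * q⁆ = ((![2, 0, -2] : Fin 3 → k) j +
        ((![0, 2] : Fin 2 → k) a + (![0, -2] : Fin 2 → k) b)) • (gen k (.x j u) * q) := by
      rw [lie_mul_freeRing, lie_H_gen, h1, smul_mul_assoc, mul_smul_comm, ← add_smul]
    fin_cases j
    · by_cases ha : a = 1
      · refine ⟨a, b, ?_, ?_, ?_⟩ <;> simp [h2 ha]
      · obtain rfl : a = 0 := by omega
        refine ⟨1, b, ?_, fun _ v => ?_, fun hb v => key _ _ (h3 hb v)⟩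
        · simpa using hH
        · change gen k (.x 0 v) * (gen k (.x 0 u) * q) = 0
          rw [← mul_assoc, gen_mul_eq_zero k (by decide), zero_mul]
    · refine ⟨a, b, ?_, fun ha v => key _ _ (h2 ha v), fun hb v => key _ _ (h3 hb v)⟩
      simpa using hH
    · by_cases hb : b = 1
      · refine ⟨a, b, ?_, ?_, ?_⟩ <;> simp [h3 hb]
      · obtain rfl : b = 0 := by omega
        refine ⟨a, 1, ?_, fun ha v => key _ _ (h2 ha v), fun _ v => ?_⟩
        · simpa [add_comm] using hH
        · change gen k (.x 2 v) * (gen k (.x 2 u) * q) = 0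
          rw [← mul_assoc, gen_mul_eq_zero k (by decide), zero_mul]

theorem smallWeights_freeRing : SmallWeights k (FreeRing k I₀ I₂) := by
  set N := Submodule.span k {q : FreeRing k I₀ I₂ | ∃ a b, IsMono k a b q} with hN
  have hone : (1 : FreeRing k I₀ I₂) ∈ N := by
    refine Submodule.subset_span ⟨0, 0, ?_, by simp, by simp⟩
    rw [← map_one (Ideal.Quotient.mk _), lie_mk]
    simp
  have hmul : ∀ l, ∀ q ∈ N, gen k l * q ∈ N := by
    intro l q hq
    induction hq using Submodule.span_induction with
    | mem q hq =>
      obtain ⟨a, b, h⟩ := hq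
      exact Submodule.subset_span (exists_isMono_gen_mul k h l)
    | zero => rw [mul_zero]; exact zero_mem _
    | add x y _ _ hx hy => rw [mul_add]; exact add_mem hx hy
    | smul c x _ hx => rw [mul_smul_comm]; exact Submodule.smul_mem _ _ hx
  intro q
  have hq : q ∈ N := by
    obtain ⟨p, rfl⟩ := Ideal.Quotient.mk_surjective q
    induction p using MvPolynomial.induction_on with
    | C a =>
      have : (Ideal.Quotient.mk (relIdeal k I₀ I₂) (MvPolynomial.C a)) = a • 1 := by
        rw [← map_one (Ideal.Quotient.mk _), mk_smul, MvPolynomial.smul_eq_C_mul, mul_one]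
      rw [this]
      exact Submodule.smul_mem _ _ hone
    | add p q hp hq => rw [map_add]; exact add_mem hp hq
    | mul_X p l hp =>
      rw [mul_comm, map_mul]
      exact hmul l _ hp
  induction hq using Submodule.span_induction with
  | mem q hq =>
    obtain ⟨a, b, h1, -⟩ := hq
    simp only [h1, lie_smul, smul_smul]
    congr 1
    fin_cases a <;> fin_cases b <;> simp <;> norm_num
  | zero => simp
  | add x y _ _ hx hy => simp only [lie_add, hx, hy, smul_add]
  | smul c x _ hx => simp only [lie_smul, hx]; rw [smul_comm]

variable [CharZero k]

variable (I₀ I₂) in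
/-- The free commutative algebra in TKK. -/
noncomputable def freeComAlg : ComAlg.{u, max u v} k where
  carrier := FreeRing k I₀ I₂
  lie_mul := lie_mul_freeRing k
  isTKK := (smallWeights_freeRing k).isTKK

end Quotient

end TKK

namespace TKK

open Module

/-! ### The universal property -/

section Universal

variable {k : Type u} [Field k] [CharZero k]
variable {U : Type v} [AddCommGroup U] [Module k U] [LieRingModule (sl2 k) U]
  [LieModule k (sl2 k) U]
variable {I₀ I₂ : Type v} {b : Basis (Letter I₀ I₂) k U}

/-- The canonical map from a module to the free commutative algebra. -/
noncomputable def toFree (hb : IsAdapted b) : U →ₗ⁅k, sl2 k⁆ (freeComAlg k I₀ I₂).carrier :=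
  { b.constr k (gen k) with
    map_lie' := by
      intro x m
      have : (b.constr k (gen k)).comp (LieModule.toEnd k (sl2 k) U x) =
          (LieModule.toEnd k (sl2 k) (FreeRing k I₀ I₂) x).comp (b.constr k (gen k)) := by
        refine b.ext fun l => ?_
        simp only [LinearMap.comp_apply, LieModule.toEnd_apply_apply, Basis.constr_basis]
        cases l with
        | z i => rw [hb.1, map_zero, lie_gen_z]
        | x j u =>
          obtain ⟨φ, hφ⟩ := hb.2 u
          have h1 : (b.constr k (gen k)).comp (φ : sl2 k →ₗ[k] U) = copyFree k u := by
            refine (sl2Basis k).ext fun j => ?_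
            rw [LinearMap.comp_apply, LieModuleHom.coe_toLinearMap, hφ, Basis.constr_basis,
              copyFree_basis]
          rw [← hφ, ← LieModuleHom.map_lie, ← copyFree_basis, lie_copyFree, ← h1]
          rfl
      exact LinearMap.congr_fun this m }

theorem toFree_basis (hb : IsAdapted b) (l : Letter I₀ I₂) : toFree hb (b l) = gen k l :=
  b.constr_basis k (gen k) l

omit [CharZero k] in
theorem lie_one (R : ComAlg.{u, w} k) (x : sl2 k) : ⁅x, (1 : R.carrier)⁆ = 0 := by
  have := R.lie_mul x 1 1
  rw [mul_one, mul_one, one_mul] at this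
  simpa using this

omit [CharZero k] in
theorem lie_algebraMap (R : ComAlg.{u, w} k) (x : sl2 k) (c : k) :
    ⁅x, algebraMap k R.carrier c⁆ = 0 := by
  rw [Algebra.algebraMap_eq_smul_one]
  exact (lie_smul c x (1 : R.carrier)).trans (by rw [lie_one, smul_zero])

/-- The product of two vectors of weight 2 has weight 4, which does not occur in TKK. Each further
relation is f applied to the previous one, the last three after division by 2, 3 and 4. -/
theorem rel_eq_zero (R : ComAlg.{u, w} k) {φ ψ : sl2 k →ₗ⁅k, sl2 k⁆ R.carrier} :
    φ (sE k) * ψ (sE k) = 0 ∧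
    φ (sH k) * ψ (sE k) + φ (sE k) * ψ (sH k) = 0 ∧
    φ (sH k) * ψ (sH k) - φ (sF k) * ψ (sE k) - φ (sE k) * ψ (sF k) = 0 ∧
    φ (sF k) * ψ (sH k) + φ (sH k) * ψ (sF k) = 0 ∧
    φ (sF k) * ψ (sF k) = 0 := by
  have hE : ∀ φ : sl2 k →ₗ⁅k, sl2 k⁆ R.carrier, ⁅sF k, φ (sE k)⁆ = -φ (sH k) := fun φ => by
    rw [← LieModuleHom.map_lie, lie_FE, map_neg]
  have hH : ∀ φ : sl2 k →ₗ⁅k, sl2 k⁆ R.carrier, ⁅sF k, φ (sH k)⁆ = (2 : k) • φ (sF k) :=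
    fun φ => by rw [← LieModuleHom.map_lie, lie_FH, map_smul]
  have hF : ∀ φ : sl2 k →ₗ⁅k, sl2 k⁆ R.carrier, ⁅sF k, φ (sF k)⁆ = 0 := fun φ => by
    rw [← LieModuleHom.map_lie, lie_self, map_zero]
  have hHE : ∀ φ : sl2 k →ₗ⁅k, sl2 k⁆ R.carrier, ⁅sH k, φ (sE k)⁆ = (2 : k) • φ (sE k) :=
    fun φ => by rw [← LieModuleHom.map_lie, lie_HE, map_smul]
  have hz : ∀ (n : ℕ) [n.AtLeastTwo] (r : R.carrier), (OfNat.ofNat n : R.carrier) * r = 0 → r = 0 := by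
    intro n _ r hr
    have h1 : (OfNat.ofNat n : k) • r = 0 := by rw [Algebra.smul_def, map_ofNat, hr]
    exact (smul_eq_zero.1 h1).resolve_left (OfNat.ofNat_ne_zero n)
  have h0 : φ (sE k) * ψ (sE k) = 0 := by
    refine R.isTKK.smallWeights.eq_zero (c := 4) ?_ (by norm_num)
    rw [R.lie_mul, hHE, hHE, smul_mul_assoc, mul_smul_comm, ← add_smul]
    norm_num
  have h1 : φ (sH k) * ψ (sE k) + φ (sE k) * ψ (sH k) = 0 := by
    have := congrArg (fun r => ⁅sF k, r⁆) h0
    simp only [R.lie_mul, hE, lie_zero] at this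
    linear_combination -this
  have h2 : φ (sH k) * ψ (sH k) - φ (sF k) * ψ (sE k) - φ (sE k) * ψ (sF k) = 0 := by
    have := congrArg (fun r => ⁅sF k, r⁆) h1
    simp only [R.lie_mul, hE, hH, lie_zero, lie_add, two_smul] at this
    refine hz 2 _ ?_
    linear_combination -this
  have h3 : φ (sF k) * ψ (sH k) + φ (sH k) * ψ (sF k) = 0 := by
    have := congrArg (fun r => ⁅sF k, r⁆) h2
    simp only [R.lie_mul, hE, hH, hF, lie_zero, lie_sub, two_smul] at this
    refine hz 3 _ ?_
    linear_combination this
  have h4 : φ (sF k) * ψ (sF k) = 0 := by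
    have := congrArg (fun r => ⁅sF k, r⁆) h3
    simp only [R.lie_mul, hH, hF, lie_zero, lie_add, two_smul] at this
    refine hz 4 _ ?_
    linear_combination this
  exact ⟨h0, h1, h2, h3, h4⟩

omit [LieModule k (sl2 k) U] in
theorem aeval_eq_zero (hb : IsAdapted b) (R : ComAlg.{u, w} k) (ψ : U →ₗ⁅k, sl2 k⁆ R.carrier)
    {p : Poly k I₀ I₂} (hp : p ∈ relIdeal k I₀ I₂) :
    MvPolynomial.aeval (fun l => ψ (b l)) p = 0 := by
  have hle : relIdeal k I₀ I₂ ≤ RingHom.ker (MvPolynomial.aeval (R := k) (fun l => ψ (b l))) := by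
    rw [relIdeal, Ideal.span_le]
    rintro _ ⟨n, u, v, rfl⟩
    obtain ⟨φ, hφ⟩ := hb.2 u
    obtain ⟨φ', hφ'⟩ := hb.2 v
    obtain ⟨h0, h1, h2, h3, h4⟩ := rel_eq_zero R (φ := ψ.comp φ) (ψ := ψ.comp φ')
    simp only [LieModuleHom.comp_apply, hφ, hφ'] at h0 h1 h2 h3 h4
    rw [SetLike.mem_coe, RingHom.mem_ker]
    fin_cases n <;> simpa [rel]
  exact hle hp

-- Both sides are derivations along the evaluation map, so it suffices to compare them on
-- generators, where equivariance of `ψ` decides.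
omit [CharZero k] [LieModule k (sl2 k) U] in
theorem aeval_act (hb : IsAdapted b) (R : ComAlg.{u, w} k) (ψ : U →ₗ⁅k, sl2 k⁆ R.carrier)
    (x : sl2 k) (p : Poly k I₀ I₂) : MvPolynomial.aeval (fun l => ψ (b l)) (act k x p) =
      ⁅x, MvPolynomial.aeval (fun l => ψ (b l)) p⁆ := by
  induction p using MvPolynomial.induction_on with
  | C a =>
    rw [MvPolynomial.algHom_C, lie_algebraMap, MvPolynomial.derivation_C, map_zero]
  | add p q hp hq => simp only [map_add, hp, hq, lie_add]
  | mul_X p l hp =>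
    have hl : MvPolynomial.aeval (fun l => ψ (b l)) (act k x (.X l)) = ⁅x, ψ (b l)⁆ := by
      rw [← LieModuleHom.map_lie]
      cases l with
      | z i => rw [act_z, hb.1, map_zero, map_zero]
      | x j u =>
        obtain ⟨φ, hφ⟩ := hb.2 u
        have h1 : (MvPolynomial.aeval (R := k) (fun l => ψ (b l))).toLinearMap.comp (copy k u) =
            (ψ.comp φ : sl2 k →ₗ[k] R.carrier) := by
          refine (sl2Basis k).ext fun j => ?_
          rw [LinearMap.comp_apply, copy_basis]
          simp [hφ]
        rw [← copy_basis, act_copy, ← hφ, ← LieModuleHom.map_lie]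
        exact LinearMap.congr_fun h1 _
    rw [Derivation.leibniz, map_add, smul_eq_mul, smul_eq_mul, map_mul, map_mul, map_mul, hl, hp,
      R.lie_mul, MvPolynomial.aeval_X]
    ring

/-- The algebra `freeComAlg` is free. -/
theorem isFreeComAlg_toFree (hb : IsAdapted b) : IsFreeComAlg (freeComAlg k I₀ I₂) (toFree hb) := by
  intro R ψ
  let g : (freeComAlg k I₀ I₂).carrier →ₐ[k] R.carrier :=
    Ideal.Quotient.liftₐ (relIdeal k I₀ I₂) (MvPolynomial.aeval (fun l => ψ (b l)))
      (fun p hp => aeval_eq_zero hb R ψ hp)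
  have hg : ∀ l, g (gen k l) = ψ (b l) := fun l => MvPolynomial.aeval_X _ _
  refine ⟨g, ⟨fun x a => ?_, fun y => ?_⟩, fun g' hg' => ?_⟩
  · obtain ⟨p, rfl⟩ := Ideal.Quotient.mk_surjective (I := relIdeal k I₀ I₂) a
    exact (congrArg g (lie_mk k x p)).trans (aeval_act hb R ψ x p)
  · have : g.toLinearMap.comp (toFree hb : U →ₗ[k] (freeComAlg k I₀ I₂).carrier) =
        (ψ : U →ₗ[k] R.carrier) := by
      refine b.ext fun l => ?_
      have := hg l
      rw [← toFree_basis hb] at this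
      exact this
    exact LinearMap.congr_fun this y
  · refine Ideal.Quotient.algHom_ext (I := relIdeal k I₀ I₂) k (MvPolynomial.algHom_ext fun l => ?_)
    have h1 := hg'.2 (b l)
    rw [toFree_basis] at h1
    exact h1.trans (hg l).symm

end Universal

end TKK

namespace TKK

open Module

/-! ### The order of the letters and the rewriting of bad pairs -/

section Order

variable {I₀ I₂ : Type v}

/-- The position of a generator in the lexicographic order by type and label. -/
def Letter.toLex' : Letter I₀ I₂ → I₀ ⊕ₗ (Fin 3 ×ₗ I₂)
  | .z i => toLex (.inl i)
  | .x j u => toLex (.inr (toLex (j, u)))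

theorem Letter.toLex'_injective : Function.Injective (Letter.toLex' (I₀ := I₀) (I₂ := I₂)) := by
  rintro (i | ⟨j, u⟩) (i' | ⟨j', u'⟩) e <;> simp_all [Letter.toLex']

variable [LinearOrder I₀] [LinearOrder I₂]

noncomputable instance : LinearOrder (Letter I₀ I₂) :=
  LinearOrder.lift' Letter.toLex' Letter.toLex'_injective

instance [WellFoundedLT I₀] [WellFoundedLT I₂] : WellFoundedLT (Letter I₀ I₂) :=
  ⟨InvImage.wf Letter.toLex' (Sum.lex_wf wellFounded_lt wellFounded_lt)⟩

theorem Letter.z_lt_z {i i' : I₀} : (.z i : Letter I₀ I₂) < .z i' ↔ i < i' :=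
  Sum.Lex.inl_lt_inl_iff

theorem Letter.z_lt_x {i : I₀} {j : Fin 3} {u : I₂} : (.z i : Letter I₀ I₂) < .x j u :=
  Sum.Lex.inl_lt_inr _ _

theorem Letter.x_lt_x {j j' : Fin 3} {u u' : I₂} :
    (.x j u : Letter I₀ I₂) < .x j' u' ↔ j < j' ∨ j = j' ∧ u < u' :=
  Sum.Lex.inr_lt_inr_iff.trans Prod.Lex.toLex_lt_toLex

/-- The pairs of neighbours that are allowed in a normal word. -/
def Good : Letter I₀ I₂ → Letter I₀ I₂ → Prop
  | .z i, .z i' => i ≤ i'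
  | .z _, .x _ _ => True
  | .x _ _, .z _ => False
  | .x j u, .x j' v => (j = 0 ∧ j' = 1 ∧ u < v) ∨ (j = 0 ∧ j' = 2) ∨ (j = 1 ∧ j' = 2 ∧ u < v)

end Order

section Reduce

variable (k : Type u) [Field k] [CharZero k] {I₀ I₂ : Type v} [LinearOrder I₀] [LinearOrder I₂]

/-- The span of the products of two generators that are smaller than a given pair. -/
noncomputable def lowerPairs (l l' : Letter I₀ I₂) : Submodule k (FreeRing k I₀ I₂) :=
  Submodule.span k {q | ∃ c c', (c < l ∨ c = l ∧ c' < l') ∧ gen k c * gen k c' = q}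

variable {k}

omit [CharZero k] in
theorem gen_mul_gen_mem {l l' c c' : Letter I₀ I₂} (h : c < l ∨ c = l ∧ c' < l') :
    gen k c * gen k c' ∈ lowerPairs k l l' :=
  Submodule.subset_span ⟨c, c', h, rfl⟩

omit [CharZero k] [LinearOrder I₀] [LinearOrder I₂] in
theorem gen_rel (n : Fin 5) (u v : I₂) : Ideal.Quotient.mk (relIdeal k I₀ I₂) (rel k n u v) = 0 :=
  Ideal.Quotient.eq_zero_iff_mem.2 (rel_mem k n u v)

omit [CharZero k] in
theorem gen_mul_gen_mem_of_lt {l l' : Letter I₀ I₂} (h : l' < l) :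
    gen k l * gen k l' ∈ lowerPairs k l l' := by
  rw [mul_comm]
  exact gen_mul_gen_mem (Or.inl h)

/-- For types e, h or h, f the product is antisymmetric in the labels: labels in the wrong order are
swapped, and for equal labels twice the product is zero. -/
theorem reduce_adjacent {j j' : Fin 3} (u v : I₂)
    (hrel : ∀ u v : I₂, gen (I₀ := I₀) k (.x j u) * gen k (.x j' v) =
      -(gen k (.x j v) * gen k (.x j' u))) (huv : ¬ u < v) :
    gen (I₀ := I₀) k (.x j u) * gen k (.x j' v) ∈ lowerPairs k (.x j u) (.x j' v) := by
  rcases (not_lt.1 huv).lt_or_eq with h | rfl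
  · rw [hrel]
    exact neg_mem (gen_mul_gen_mem (Or.inl (Letter.x_lt_x.2 (Or.inr ⟨rfl, h⟩))))
  · have h1 := hrel v v
    rw [eq_neg_iff_add_eq_zero, ← two_smul k] at h1
    rw [(smul_eq_zero.1 h1).resolve_left two_ne_zero]
    exact zero_mem _

/-- Letters in the wrong order commute; ee and ff vanish; hh is traded for two products ef by the
relation of weight 0, and these are smaller because e < h; eh and hf are antisymmetric. -/
theorem gen_mul_gen_mem_lowerPairs (l l' : Letter I₀ I₂) (h : ¬ Good l l') :
    gen k l * gen k l' ∈ lowerPairs k l l' := by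
  rcases l with i | ⟨j, u⟩ <;> rcases l' with i' | ⟨j', v⟩
  · exact gen_mul_gen_mem_of_lt (Letter.z_lt_z.2 (not_le.1 h))
  · exact absurd trivial h
  · exact gen_mul_gen_mem_of_lt Letter.z_lt_x
  · by_cases hjj : j' < j
    · exact gen_mul_gen_mem_of_lt (Letter.x_lt_x.2 (Or.inl hjj))
    by_cases hj : j = j'
    · subst hj
      by_cases h1 : j = 1
      · subst h1
        have hr := gen_rel (k := k) (I₀ := I₀) 2 u v
        simp only [rel, map_sub, map_mul] at hr
        have e : gen (I₀ := I₀) k (.x 1 u) * gen k (.x 1 v) =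
            gen k (.x 0 v) * gen k (.x 2 u) + gen k (.x 0 u) * gen k (.x 2 v) := by
          rw [gen, gen, gen, gen, gen, gen]
          linear_combination hr
        rw [e]
        exact add_mem (gen_mul_gen_mem (Or.inl (Letter.x_lt_x.2 (Or.inl (by decide)))))
          (gen_mul_gen_mem (Or.inl (Letter.x_lt_x.2 (Or.inl (by decide)))))
      · rw [gen_mul_eq_zero k h1]
        exact zero_mem _
    have hcases : (j = 0 ∧ j' = 1) ∨ (j = 0 ∧ j' = 2) ∨ (j = 1 ∧ j' = 2) := by omega
    rcases hcases with ⟨rfl, rfl⟩ | ⟨rfl, rfl⟩ | ⟨rfl, rfl⟩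
    · refine reduce_adjacent u v (fun u v => ?_) fun huv => h (Or.inl ⟨rfl, rfl, huv⟩)
      have hr := gen_rel (k := k) (I₀ := I₀) 1 u v
      simp only [rel, map_add, map_mul] at hr
      rw [gen, gen, gen, gen]
      linear_combination hr
    · exact absurd (Or.inr (Or.inl ⟨rfl, rfl⟩)) h
    · refine reduce_adjacent u v (fun u v => ?_) fun huv => h (Or.inr (Or.inr ⟨rfl, rfl, huv⟩))
      have hr := gen_rel (k := k) (I₀ := I₀) 3 u v
      simp only [rel, map_add, map_mul] at hr
      rw [gen, gen, gen, gen]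
      linear_combination hr

end Reduce

/-! ### A model that detects the normal words -/

section Model

variable (k : Type u) [Field k] (I : Type v)

/-- A commutative algebra in which the normal words in the generators of `L(2)` are linearly
independent. An element has coordinates on the unit, on the three types of generators, on the three
kinds of products of two generators, and on the products of three generators. -/
@[ext]
structure Model where
  /-- the coordinate on the unit -/
  a : k
  /-- the coordinates on the generators of type `e` -/
  e : I → k
  /-- the coordinates on the generators of type `h` -/
  h : I → k
  /-- the coordinates on the generators of type `f` -/
  f : I → k
  /-- the coordinates on the products of type `eh` -/
  eh : I → I → k
  /-- the coordinates on the products of type `hf` -/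
  hf : I → I → k
  /-- the coordinates on the products of type `ef` -/
  ef : I → I → k
  /-- the coordinates on the products of type `ehf` -/
  ehf : I → I → I → k

variable {k I}

namespace Model

instance : Zero (Model k I) := ⟨⟨0, 0, 0, 0, 0, 0, 0, 0⟩⟩
instance : One (Model k I) := ⟨⟨1, 0, 0, 0, 0, 0, 0, 0⟩⟩
instance : Add (Model k I) := ⟨fun p q => ⟨p.a + q.a, p.e + q.e, p.h + q.h, p.f + q.f,
  p.eh + q.eh, p.hf + q.hf, p.ef + q.ef, p.ehf + q.ehf⟩⟩
instance : Neg (Model k I) := ⟨fun p => ⟨-p.a, -p.e, -p.h, -p.f, -p.eh, -p.hf, -p.ef, -p.ehf⟩⟩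
instance : SMul k (Model k I) := ⟨fun c p => ⟨c * p.a, c • p.e, c • p.h, c • p.f,
  c • p.eh, c • p.hf, c • p.ef, c • p.ehf⟩⟩

/-- The part of degree three of the product of an element of degree one and an element of
degree two. -/
def cubic (p q : Model k I) (i j l : I) : k :=
  p.e i * q.hf j l - p.e j * q.hf i l + p.e l * q.hf i j
    + p.h j * (q.ef i l - q.ef l i) - p.h i * (q.ef j l - q.ef l j)
    - p.h l * (q.ef i j - q.ef j i)
    + p.f l * q.eh i j - p.f j * q.eh i l + p.f i * q.eh j l

/-- Products eh and hf are alternating in the labels, and h_i h_j = e_i f_j + e_j f_i. In degree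
three only the alternating part of ef contributes, and degrees above three vanish. Coordinates need
not be alternating or finitely supported: the model only has to be large enough to separate normal
words. -/
instance : Mul (Model k I) := ⟨fun p q =>
  { a := p.a * q.a
    e := fun i => p.a * q.e i + p.e i * q.a
    h := fun i => p.a * q.h i + p.h i * q.a
    f := fun i => p.a * q.f i + p.f i * q.a
    eh := fun i j => p.a * q.eh i j + p.eh i j * q.a +
      (p.e i * q.h j + p.h j * q.e i - p.e j * q.h i - p.h i * q.e j)
    hf := fun i j => p.a * q.hf i j + p.hf i j * q.a +
      (p.h i * q.f j + p.f j * q.h i - p.h j * q.f i - p.f i * q.h j)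
    ef := fun i j => p.a * q.ef i j + p.ef i j * q.a +
      (p.e i * q.f j + p.f j * q.e i + p.h i * q.h j + p.h j * q.h i)
    ehf := fun i j l => p.a * q.ehf i j l + p.ehf i j l * q.a + cubic p q i j l +
      cubic q p i j l }⟩

section

variable (p q : Model k I) (i j l : I) (c : k)

@[simp] theorem zero_a : (0 : Model k I).a = 0 := rfl
@[simp] theorem zero_e : (0 : Model k I).e = 0 := rfl
@[simp] theorem zero_h : (0 : Model k I).h = 0 := rfl
@[simp] theorem zero_f : (0 : Model k I).f = 0 := rfl
@[simp] theorem zero_eh : (0 : Model k I).eh = 0 := rfl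
@[simp] theorem zero_hf : (0 : Model k I).hf = 0 := rfl
@[simp] theorem zero_ef : (0 : Model k I).ef = 0 := rfl
@[simp] theorem zero_ehf : (0 : Model k I).ehf = 0 := rfl
@[simp] theorem one_a : (1 : Model k I).a = 1 := rfl
@[simp] theorem one_e : (1 : Model k I).e = 0 := rfl
@[simp] theorem one_h : (1 : Model k I).h = 0 := rfl
@[simp] theorem one_f : (1 : Model k I).f = 0 := rfl
@[simp] theorem one_eh : (1 : Model k I).eh = 0 := rfl
@[simp] theorem one_hf : (1 : Model k I).hf = 0 := rfl
@[simp] theorem one_ef : (1 : Model k I).ef = 0 := rfl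
@[simp] theorem one_ehf : (1 : Model k I).ehf = 0 := rfl
@[simp] theorem add_a : (p + q).a = p.a + q.a := rfl
@[simp] theorem add_e : (p + q).e = p.e + q.e := rfl
@[simp] theorem add_h : (p + q).h = p.h + q.h := rfl
@[simp] theorem add_f : (p + q).f = p.f + q.f := rfl
@[simp] theorem add_eh : (p + q).eh = p.eh + q.eh := rfl
@[simp] theorem add_hf : (p + q).hf = p.hf + q.hf := rfl
@[simp] theorem add_ef : (p + q).ef = p.ef + q.ef := rfl
@[simp] theorem add_ehf : (p + q).ehf = p.ehf + q.ehf := rfl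
@[simp] theorem neg_a : (-p).a = -p.a := rfl
@[simp] theorem neg_e : (-p).e = -p.e := rfl
@[simp] theorem neg_h : (-p).h = -p.h := rfl
@[simp] theorem neg_f : (-p).f = -p.f := rfl
@[simp] theorem neg_eh : (-p).eh = -p.eh := rfl
@[simp] theorem neg_hf : (-p).hf = -p.hf := rfl
@[simp] theorem neg_ef : (-p).ef = -p.ef := rfl
@[simp] theorem neg_ehf : (-p).ehf = -p.ehf := rfl
@[simp] theorem smul_a : (c • p).a = c * p.a := rfl
@[simp] theorem smul_e : (c • p).e = c • p.e := rfl
@[simp] theorem smul_h : (c • p).h = c • p.h := rfl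
@[simp] theorem smul_f : (c • p).f = c • p.f := rfl
@[simp] theorem smul_eh : (c • p).eh = c • p.eh := rfl
@[simp] theorem smul_hf : (c • p).hf = c • p.hf := rfl
@[simp] theorem smul_ef : (c • p).ef = c • p.ef := rfl
@[simp] theorem smul_ehf : (c • p).ehf = c • p.ehf := rfl
@[simp] theorem mul_a : (p * q).a = p.a * q.a := rfl
@[simp] theorem mul_e : (p * q).e i = p.a * q.e i + p.e i * q.a := rfl
@[simp] theorem mul_h : (p * q).h i = p.a * q.h i + p.h i * q.a := rfl
@[simp] theorem mul_f : (p * q).f i = p.a * q.f i + p.f i * q.a := rfl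
@[simp] theorem mul_eh : (p * q).eh i j = p.a * q.eh i j + p.eh i j * q.a +
    (p.e i * q.h j + p.h j * q.e i - p.e j * q.h i - p.h i * q.e j) := rfl
@[simp] theorem mul_hf : (p * q).hf i j = p.a * q.hf i j + p.hf i j * q.a +
    (p.h i * q.f j + p.f j * q.h i - p.h j * q.f i - p.f i * q.h j) := rfl
@[simp] theorem mul_ef : (p * q).ef i j = p.a * q.ef i j + p.ef i j * q.a +
    (p.e i * q.f j + p.f j * q.e i + p.h i * q.h j + p.h j * q.h i) := rfl
@[simp] theorem mul_ehf : (p * q).ehf i j l = p.a * q.ehf i j l + p.ehf i j l * q.a +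
    cubic p q i j l + cubic q p i j l := rfl

end

instance : CommRing (Model k I) where
  add_assoc p q r := by ext <;> simp <;> ring
  zero_add p := by ext <;> simp
  add_zero p := by ext <;> simp
  add_comm p q := by ext <;> simp <;> ring
  neg_add_cancel p := by ext <;> simp
  mul_assoc p q r := by ext <;> simp [cubic] <;> ring
  mul_comm p q := by ext <;> simp [cubic] <;> ring
  one_mul p := by ext <;> simp [cubic]
  mul_one p := by ext <;> simp [cubic]
  zero_mul p := by ext <;> simp [cubic]
  mul_zero p := by ext <;> simp [cubic]
  left_distrib p q r := by ext <;> simp [cubic] <;> ring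
  right_distrib p q r := by ext <;> simp [cubic] <;> ring
  nsmul := nsmulRec
  zsmul := zsmulRec

instance : Module k (Model k I) where
  one_smul p := by ext <;> simp
  mul_smul c d p := by ext <;> simp <;> ring
  smul_zero c := by ext <;> simp
  smul_add c p q := by ext <;> simp <;> ring
  add_smul c d p := by ext <;> simp <;> ring
  zero_smul p := by ext <;> simp

instance : Algebra k (Model k I) := Algebra.ofModule
  (fun c p q => by ext <;> simp [cubic] <;> ring) (fun c p q => by ext <;> simp [cubic] <;> ring)

end Model

end Model

end TKK

namespace TKK

open Module

section Detect

variable {k : Type u} [Field k] {I : Type v} [LinearOrder I]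

variable (k) in
/-- The generators of the model. -/
def Model.gen (l : Fin 3 × I) : Model k I :=
  match l.1 with
  | 0 => ⟨0, Pi.single l.2 1, 0, 0, 0, 0, 0, 0⟩
  | 1 => ⟨0, 0, Pi.single l.2 1, 0, 0, 0, 0, 0⟩
  | 2 => ⟨0, 0, 0, Pi.single l.2 1, 0, 0, 0, 0⟩

/-- The normal words in the generators of `L(2)`. -/
inductive IsTail : List (Fin 3 × I) → Prop
  | nil : IsTail []
  | e (u) : IsTail [(0, u)]
  | h (u) : IsTail [(1, u)]
  | f (u) : IsTail [(2, u)]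
  | eh (u v) (huv : u < v) : IsTail [(0, u), (1, v)]
  | hf (u v) (huv : u < v) : IsTail [(1, u), (2, v)]
  | ef (u v) : IsTail [(0, u), (2, v)]
  | ehf (u v w) (huv : u < v) (hvw : v < w) : IsTail [(0, u), (1, v), (2, w)]

/-- The coordinate of the model that corresponds to a normal word. -/
def Model.coord (t : List (Fin 3 × I)) : Model k I →ₗ[k] k where
  toFun p := match t with
    | [] => p.a
    | [(0, u)] => p.e u
    | [(1, u)] => p.h u
    | [(2, u)] => p.f u
    | [(0, u), (1, v)] => p.eh u v
    | [(1, u), (2, v)] => p.hf u v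
    | [(0, u), (2, v)] => p.ef u v
    | [(0, u), (1, v), (2, w)] => p.ehf u v w
    | _ => 0
  map_add' p q := by split <;> simp
  map_smul' c p := by split <;> simp

/-- The `eh`, `hf` and `ehf` coordinates of a product of generators also take nonzero values at
permuted labels; restricting to increasing labels is what makes the coordinates dual to the normal
words. -/
theorem Model.coord_prod {t t' : List (Fin 3 × I)} (ht : IsTail t) (ht' : IsTail t') :
    Model.coord t (t'.map (Model.gen k)).prod = if t = t' then 1 else 0 := by
  cases ht <;> cases ht' <;> simp [Model.coord, Model.gen, Model.cubic, Pi.single_apply] <;> grind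

end Detect

/-! ### Linear independence of the normal words -/

section Independent

variable (k : Type u) [Field k] {I₀ I₂ : Type v} [LinearOrder I₀] [LinearOrder I₂]

/-- The images of the generators in the polynomials over the model. -/
noncomputable def detectLetter : Letter I₀ I₂ → MvPolynomial I₀ (Model k I₂)
  | .z i => .X i
  | .x j u => .C (Model.gen k (j, u))

omit [LinearOrder I₀] in
theorem aeval_detectLetter_rel (n : Fin 5) (u v : I₂) :
    MvPolynomial.aeval (detectLetter (I₀ := I₀) k) (rel k n u v) = 0 := by
  fin_cases n <;>
    simp only [rel, map_add, map_sub, map_mul, MvPolynomial.aeval_X, detectLetter] <;>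
    simp only [← MvPolynomial.C_mul, ← MvPolynomial.C_add, ← MvPolynomial.C_sub] <;>
    rw [← MvPolynomial.C_0] <;> congr 1 <;> ext <;>
    simp [Model.gen, Model.cubic, sub_eq_add_neg]

variable (I₀ I₂) in
/-- The homomorphism from the free commutative algebra to the polynomials over the model. -/
noncomputable def detect : FreeRing k I₀ I₂ →ₐ[k] MvPolynomial I₀ (Model k I₂) :=
  Ideal.Quotient.liftₐ (relIdeal k I₀ I₂) (MvPolynomial.aeval (detectLetter k)) (by
    intro p hp
    have hle : relIdeal k I₀ I₂ ≤ RingHom.ker (MvPolynomial.aeval (R := k) (detectLetter k)) := by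
      rw [relIdeal, Ideal.span_le]
      rintro _ ⟨n, u, v, rfl⟩
      exact aeval_detectLetter_rel k n u v
    exact hle hp)

omit [LinearOrder I₀] in
theorem detect_gen (l : Letter I₀ I₂) : detect k I₀ I₂ (gen k l) = detectLetter k l :=
  MvPolynomial.aeval_X _ _

/-- The labels of the letters of a word that come from `L(0)`. -/
def zPart (w : List (Letter I₀ I₂)) : List I₀ :=
  w.filterMap fun l => match l with
    | .z i => some i
    | .x _ _ => none

/-- The types and labels of the letters of a word that come from `L(2)`. -/
def xPart (w : List (Letter I₀ I₂)) : List (Fin 3 × I₂) :=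
  w.filterMap fun l => match l with
    | .z _ => none
    | .x j u => some (j, u)

theorem detect_prod (w : List (Letter I₀ I₂)) : detect k I₀ I₂ (w.map (gen k)).prod =
    MvPolynomial.monomial (Multiset.toFinsupp (zPart w : Multiset I₀))
      ((xPart w).map (Model.gen k)).prod := by
  induction w with
  | nil => simp [zPart, xPart]
  | cons l w ih =>
    rw [List.map_cons, List.prod_cons, map_mul, ih, detect_gen]
    cases l with
    | z i =>
      have h1 : zPart (.z i :: w) = i :: zPart w := rfl
      have h2 : xPart (.z i :: w) = xPart w := rfl
      rw [h1, h2, ← Multiset.cons_coe, ← Multiset.singleton_add, map_add,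
        Multiset.toFinsupp_singleton, MvPolynomial.monomial_single_add, pow_one, detectLetter]
    | x j u =>
      have h1 : zPart (.x j u :: w) = zPart w := rfl
      have h2 : xPart (.x j u :: w) = (j, u) :: xPart w := rfl
      rw [h1, h2, List.map_cons, List.prod_cons, detectLetter, MvPolynomial.C_mul_monomial]

/-- Along a good word no z follows a letter of L(2), and the type strictly increases in e < h < f,
so that at most three letters remain. -/
theorem exists_isTail_of_isChain {j : Fin 3} {u : I₂} {w : List (Letter I₀ I₂)}
    (h : (.x j u :: w).IsChain Good) :
    ∃ t : List (Fin 3 × I₂), w = t.map (fun p => .x p.1 p.2) ∧ IsTail ((j, u) :: t) := by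
  rcases w with _ | ⟨i | ⟨j', v⟩, w⟩
  · refine ⟨[], rfl, ?_⟩
    fin_cases j
    exacts [.e u, .h u, .f u]
  · simp [Good] at h
  rcases w with _ | ⟨i | ⟨j'', y⟩, w⟩
  · refine ⟨[(j', v)], rfl, ?_⟩
    simp only [List.isChain_cons_cons, Good, List.isChain_singleton, and_true] at h
    rcases h with ⟨rfl, rfl, h⟩ | ⟨rfl, rfl⟩ | ⟨rfl, rfl, h⟩
    exacts [.eh u v h, .ef u v, .hf u v h]
  · simp [Good] at h
  simp only [List.isChain_cons_cons, Good] at h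
  obtain ⟨h1, h2, h3⟩ := h
  obtain ⟨rfl, rfl, rfl, huv, hvy⟩ : j = 0 ∧ j' = 1 ∧ j'' = 2 ∧ u < v ∧ v < y := by grind
  rcases w with _ | ⟨i | ⟨j', y'⟩, w⟩
  · exact ⟨[(1, v), (2, y)], rfl, .ehf u v y huv hvy⟩
  · simp [Good] at h3
  · simp [Good] at h3

theorem exists_of_isChain {w : List (Letter I₀ I₂)} (h : w.IsChain Good) :
    ∃ (s : List I₀) (t : List (Fin 3 × I₂)),
      w = s.map .z ++ t.map (fun p => .x p.1 p.2) ∧ s.IsChain (· ≤ ·) ∧ IsTail t := by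
  induction w with
  | nil => exact ⟨[], [], rfl, .nil, .nil⟩
  | cons l w ih =>
    cases l with
    | x j u =>
      obtain ⟨t, rfl, ht⟩ := exists_isTail_of_isChain h
      exact ⟨[], (j, u) :: t, rfl, .nil, ht⟩
    | z i =>
      obtain ⟨s, t, rfl, hs, ht⟩ := ih h.tail
      refine ⟨i :: s, t, rfl, ?_, ht⟩
      cases s with
      | nil => exact .singleton _
      | cons i' s =>
        simp only [List.map_cons, List.cons_append, List.isChain_cons_cons] at h
        exact List.isChain_cons_cons.2 ⟨h.1, hs⟩

theorem zPart_append_xPart {w : List (Letter I₀ I₂)} (h : w.IsChain Good) :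
    w = (zPart w).map .z ++ (xPart w).map (fun p => .x p.1 p.2) ∧ (zPart w).IsChain (· ≤ ·) ∧
      IsTail (xPart w) := by
  obtain ⟨s, t, rfl, hs, ht⟩ := exists_of_isChain h
  have h1 : zPart (s.map .z ++ t.map (fun p => (.x p.1 p.2 : Letter I₀ I₂))) = s := by
    simp [zPart, List.filterMap_append, List.filterMap_map]
  have h2 : xPart (s.map .z ++ t.map (fun p => (.x p.1 p.2 : Letter I₀ I₂))) = t := by
    simp [xPart, List.filterMap_append, List.filterMap_map]
  rw [h1, h2]
  exact ⟨rfl, hs, ht⟩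

/-- The normal words in the generators of the free commutative algebra are linearly independent. -/
theorem linearIndependent_normal : LinearIndependent k
    fun w : {w : List (Letter I₀ I₂) // w.IsChain Good} => (w.1.map (gen k)).prod := by
  have key : ∀ w w' : {w : List (Letter I₀ I₂) // w.IsChain Good},
      Model.coord (xPart w.1) (MvPolynomial.coeff (Multiset.toFinsupp (zPart w.1 : Multiset I₀))
        (detect k I₀ I₂ (w'.1.map (gen k)).prod)) = if w = w' then 1 else 0 := by
    rintro ⟨w, hw⟩ ⟨w', hw'⟩
    obtain ⟨h1, h2, h3⟩ := zPart_append_xPart hw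
    obtain ⟨h1', h2', h3'⟩ := zPart_append_xPart hw'
    rw [detect_prod, MvPolynomial.coeff_monomial]
    simp only [Subtype.mk.injEq]
    by_cases hz : zPart w = zPart w'
    · rw [if_pos (by rw [hz]), Model.coord_prod h3 h3']
      refine if_congr ⟨fun h => ?_, fun h => by rw [h]⟩ rfl rfl
      rw [h1, h1', hz, h]
    · rw [if_neg, map_zero, if_neg]
      · rintro rfl
        exact hz rfl
      · intro h
        -- A monomial in the z's remembers only a multiset, but the z-parts of good words are
        -- sorted.
        have h4 : (zPart w').Perm (zPart w) := Multiset.coe_eq_coe.1 (Multiset.toFinsupp.injective h)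
        exact hz (h4.symm.eq_of_pairwise' h2.pairwise h2'.pairwise)
  let f : {w : List (Letter I₀ I₂) // w.IsChain Good} → Dual k (FreeRing k I₀ I₂) := fun w =>
    (Model.coord (xPart w.1)).comp (((MvPolynomial.lcoeff (Model k I₂)
      (Multiset.toFinsupp (zPart w.1 : Multiset I₀))).restrictScalars k).comp
        (detect k I₀ I₂).toLinearMap)
  refine LinearIndependent.of_pairwise_dual_eq_zero_one _ f (fun w w' hne => ?_) fun w => ?_
  · exact (key w w').trans (if_neg hne)
  · exact (key w w).trans (if_pos rfl)

end Independent

end TKK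

namespace Koszul

/-! ### Transport along isomorphisms -/

section Transport

variable {k : Type u} [Field k] {V : Type v} [AddCommGroup V] [Module k V] {S : Type w}
  {b : Module.Basis S k V} {good : S → S → Prop}

theorem IsPBW.map {A A' : Type*} [Ring A] [Algebra k A] [Ring A'] [Algebra k A'] [LinearOrder S]
    {η : V →ₗ[k] A} (h : IsPBW b η good) (g : A ≃ₐ[k] A') {η' : V →ₗ[k] A'}
    (hg : ∀ v, g (η v) = η' v) : IsPBW b η' good := by
  have hlift : TensorAlgebra.lift k η' = (g : A →ₐ[k] A').comp (TensorAlgebra.lift k η) := by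
    refine TensorAlgebra.hom_ext (LinearMap.ext fun v => ?_)
    simp [hg]
  refine ⟨?_, ?_, fun a c hac => ?_⟩
  · rw [hlift]
    exact g.surjective.comp h.surjective
  · rw [hlift]
    exact h.linearIndependent.map' g.toLinearMap (LinearMap.ker_eq_bot.2 g.injective)
  · obtain ⟨t, ht, ht'⟩ := h.reduce a c hac
    refine ⟨t, ht, ?_⟩
    rw [hlift]
    exact congrArg g ht'

end Transport

end Koszul

namespace TKK

open Module

/-! ### The free algebra is PBW; conclusion -/

section Main

variable {k : Type u} [Field k] {U : Type v} [AddCommGroup U] [Module k U]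
  [LieRingModule (sl2 k) U] [LieModule k (sl2 k) U]

theorem IsFreeComAlg.exists_algEquiv {F F' : ComAlg.{u, w} k} {η : U →ₗ⁅k, sl2 k⁆ F.carrier}
    {η' : U →ₗ⁅k, sl2 k⁆ F'.carrier} (h : IsFreeComAlg F η) (h' : IsFreeComAlg F' η') :
    ∃ g : F.carrier ≃ₐ[k] F'.carrier, ∀ y, g (η y) = η' y := by
  obtain ⟨g, ⟨hg, hg'⟩, -⟩ := h F' η'
  obtain ⟨q, ⟨hq, hq'⟩, -⟩ := h' F η
  refine ⟨AlgEquiv.ofAlgHom g q ?_ ?_, hg'⟩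
  · exact (h' F' η').unique ⟨fun x a => by simp [hg, hq], fun y => by simp [hg', hq']⟩
      ⟨fun x a => rfl, fun y => rfl⟩
  · exact (h F η).unique ⟨fun x a => by simp [hg, hq], fun y => by simp [hg', hq']⟩
      ⟨fun x a => rfl, fun y => rfl⟩

variable [CharZero k] {I₀ I₂ : Type v} {b : Basis (Letter I₀ I₂) k U}

theorem lift_toFree_wd (hb : IsAdapted b) (w : List (Letter I₀ I₂)) :
    TensorAlgebra.lift k (toFree hb : U →ₗ[k] (freeComAlg k I₀ I₂).carrier) (Koszul.wd b w) =
      (w.map (gen k)).prod := by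
  induction w with
  | nil => rw [Koszul.wd_nil, map_one]; rfl
  | cons l w ih =>
    rw [Koszul.wd_cons, map_mul, ih, TensorAlgebra.lift_ι_apply, List.map_cons, List.prod_cons,
      ← toFree_basis hb]
    rfl

theorem isPBW_toFree [LinearOrder I₀] [LinearOrder I₂] (hb : IsAdapted b) :
    Koszul.IsPBW b (toFree hb : U →ₗ[k] (freeComAlg k I₀ I₂).carrier) Good where
  surjective := by
    rw [← AlgHom.range_eq_top, eq_top_iff]
    rintro q -
    obtain ⟨p, rfl⟩ := Ideal.Quotient.mk_surjective (I := relIdeal k I₀ I₂) q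
    induction p using MvPolynomial.induction_on with
    | C a => exact Subalgebra.algebraMap_mem (R := k) _ a
    | add p q hp hq => exact add_mem hp hq
    | mul_X p l hp =>
      refine (map_mul (Ideal.Quotient.mk (relIdeal k I₀ I₂)) p (.X l)).symm ▸ mul_mem hp ⟨TensorAlgebra.ι k (b l), ?_⟩
      exact (TensorAlgebra.lift_ι_apply _ _).trans (toFree_basis hb l)
  linearIndependent := by
    simp only [lift_toFree_wd]
    exact linearIndependent_normal k
  reduce l l' h := by
    rw [lift_toFree_wd]
    have h1 := gen_mul_gen_mem_lowerPairs (k := k) l l' h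
    have h2 : lowerPairs k l l' ≤ (Koszul.spanW b {w | Koszul.Lower w [l, l']}).map
        (TensorAlgebra.lift k
          (toFree hb : U →ₗ[k] (freeComAlg k I₀ I₂).carrier)).toLinearMap := by
      refine Submodule.span_le.2 ?_
      rintro _ ⟨c, c', hc, rfl⟩
      refine ⟨Koszul.wd b [c, c'], Koszul.wd_mem_spanW b ⟨rfl, ?_⟩, ?_⟩
      · rcases hc with hc | ⟨rfl, hc⟩
        · exact .rel hc
        · exact .cons (.rel hc)
      · refine (lift_toFree_wd hb _).trans ?_
        rw [List.map_cons, List.map_singleton, List.prod_cons, List.prod_singleton]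
    rw [List.map_cons, List.map_singleton, List.prod_cons, List.prod_singleton]
    exact h2 h1

end Main

end TKK

theorem mainTheorem4 {k : Type u} [Field k] [CharZero k]
    {U : Type v} [AddCommGroup U] [Module k U]
    [LieRingModule (TKK.sl2 k) U] [LieModule k (TKK.sl2 k) U] (hU : TKK.IsTKK k U) :
    (∃ (F : TKK.ComAlg.{u, max u v} k) (η : U →ₗ⁅k, TKK.sl2 k⁆ F.carrier),
      TKK.IsFreeComAlg F η) ∧
    ∀ (F : TKK.ComAlg.{u, max u v} k) (η : U →ₗ⁅k, TKK.sl2 k⁆ F.carrier),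
      TKK.IsFreeComAlg F η → Koszul.IsQuadraticKoszul (η : U →ₗ[k] F.carrier) := by
  obtain ⟨I₀, I₂, b, hb⟩ := hU.exists_isAdapted
  refine ⟨⟨TKK.freeComAlg k I₀ I₂, TKK.toFree hb, TKK.isFreeComAlg_toFree hb⟩, fun F η h => ?_⟩
  -- The orders on the labels are arbitrary; well-orders are chosen so that rewriting terminates,
  -- also for infinitely many generators.
  obtain ⟨_, _⟩ := exists_wellFoundedLT I₀
  obtain ⟨_, _⟩ := exists_wellFoundedLT I₂
  obtain ⟨g, hg⟩ := (TKK.isFreeComAlg_toFree hb).exists_algEquiv h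
  exact ((TKK.isPBW_toFree hb).map g hg).isQuadraticKoszul
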